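/- For $p\in\mathbb{C}[z_1,z_2]$ let $\mathcal{I}(p)=\{(\operatorname{Im} z_1,\operatorname{Im} z_2) : z\in\mathbb{C}^2,\ p(z)=0\}\subseteq\mathbb{R}^2$ be its imaginary projection, and let $\partial\mathcal{I}(p)=\overline{\mathcal{I}(p)}\cap\overline{\mathcal{I}(p)^{\mathsf c}}$, where $^{\mathsf c}$ and $\overline{\,\cdot\,}$ denote the complement and the Euclidean closure in $\mathbb{R}^2$. A complex conic is a polynomial $p\in\mathbb{C}[z_1,z_2]$ of total degree exactly two. A subset of $\mathbb{R}^2$ is algebraic if it is the common zero set of a set of real polynomials; Zariski closures and irreducible components are taken in $\mathbb{R}^2$. The degree of a point (and of the whole plane) is $1$, and the degree of an irreducible algebraic curve in $\mathbb{R}^2$ is the total degree of an irreducible polynomial generating its vanishing ideal. Then: 1. (a) There is a complex conic $p$ such that $\partial\mathcal{I}(p)$ is not algebraic. (b) For every complex conic $p$, the Zariski closure of $\partial\mathcal{I}(p)$ is a proper subset of $\mathbb{R}^2$, and each of its irreducible components has degree at most $8$. (c) The bound $8$ is attained: for the complex conic $p=z_1^2+\mathrm{i}z_2^2+z_2$ the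 Zariski closure of $\partial\mathcal{I}(p)$ is irreducible of degree $8$, and the vanishing ideal of $\partial\mathcal{I}(p)$ in $\mathbb{R}[y_1,y_2]$ is generated by a polynomial of total degree $8$ that is irreducible over $\mathbb{C}$. (d) If $p$ is a complex conic such that $\mathcal{I}(p)^{\mathsf c}$ has no bounded connected component, then $\partial\mathcal{I}(p)$ is algebraic and all its irreducible components have degree at most two. 2. If $p$ is a complex conic all of whose coefficients are real, then $\partial\mathcal{I}(p)$ is algebraic and all its irreducible components have degree at most two. -/

import Mathlib

open MvPolynomial

/-- The imaginary projection of `p ∈ ℂ[z₁, …, zₙ]`: the set of all vectors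
`(Im z₁, …, Im zₙ)` with `z ∈ ℂⁿ` and `p(z) = 0`. -/
def imagProjection {n : ℕ} (p : MvPolynomial (Fin n) ℂ) : Set (Fin n → ℝ) :=
  {y | ∃ z : Fin n → ℂ, eval z p = 0 ∧ ∀ j, (z j).im = y j}

/-- The boundary `∂I(p)`: the intersection of the closures of `I(p)` and of its complement,
for the usual topology of `ℝⁿ`. -/
def imagBoundary {n : ℕ} (p : MvPolynomial (Fin n) ℂ) : Set (Fin n → ℝ) :=
  closure (imagProjection p) ∩ closure (imagProjection p)ᶜ

/-- A complex conic: a bivariate complex polynomial of total degree two. -/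
def IsComplexConic (p : MvPolynomial (Fin 2) ℂ) : Prop :=
  p.totalDegree = 2

/-- All coefficients of `p` are real. -/
def HasRealCoeffs {n : ℕ} (p : MvPolynomial (Fin n) ℂ) : Prop :=
  ∀ m : Fin n →₀ ℕ, (p.coeff m).im = 0

/-- The complement of `I(p)` has no bounded connected component. -/
def NoBoundedComplementComponent {n : ℕ} (p : MvPolynomial (Fin n) ℂ) : Prop :=
  ∀ y ∈ (imagProjection p)ᶜ,
    ¬ Bornology.IsBounded (connectedComponentIn (imagProjection p)ᶜ y)

/-- Algebraic subsets of `ℝⁿ` (Zariski closed sets): common zero sets of real polynomials. -/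
def IsAlgebraicSet {n : ℕ} (V : Set (Fin n → ℝ)) : Prop :=
  ∃ I : Ideal (MvPolynomial (Fin n) ℝ), V = zeroLocus ℝ I

/-- The Zariski closure of a subset of `ℝⁿ`. -/
def zariskiClosure {n : ℕ} (S : Set (Fin n → ℝ)) : Set (Fin n → ℝ) :=
  zeroLocus ℝ (vanishingIdeal ℝ S)

/-- Irreducible algebraic sets: nonempty, and not the union of two proper algebraic subsets. -/
def IsIrreducibleAlgebraicSet {n : ℕ} (V : Set (Fin n → ℝ)) : Prop :=
  IsAlgebraicSet V ∧ V.Nonempty ∧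
    ∀ V₁ V₂ : Set (Fin n → ℝ), IsAlgebraicSet V₁ → IsAlgebraicSet V₂ →
      V = V₁ ∪ V₂ → V = V₁ ∨ V = V₂

/-- `Z` is an irreducible component of `W`: a maximal irreducible algebraic subset of `W`. -/
def IsIrreducibleComponent {n : ℕ} (Z W : Set (Fin n → ℝ)) : Prop :=
  Maximal (fun V => IsIrreducibleAlgebraicSet V ∧ V ⊆ W) Z

/-- The degree of an irreducible algebraic subset of the plane: points and the whole plane have
degree one, and the degree of a curve is the total degree of an irreducible polynomial that
generates its vanishing ideal. -/
def HasDegree (V : Set (Fin 2 → ℝ)) (d : ℕ) : Prop :=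
  (((∃ a, V = {a}) ∨ V = Set.univ) ∧ d = 1) ∨
    ∃ f : MvPolynomial (Fin 2) ℝ,
      Irreducible f ∧ vanishingIdeal ℝ V = Ideal.span {f} ∧ d = f.totalDegree

/-- Every irreducible component of the Zariski closure of `S` has degree at most `d`. -/
def ComponentsHaveDegreeAtMost (S : Set (Fin 2 → ℝ)) (d : ℕ) : Prop :=
  ∀ Z, IsIrreducibleComponent Z (zariskiClosure S) → ∃ e ≤ d, HasDegree Z e

/-- The conic `z₁² + i z₂² + z₂`. -/
noncomputable def exampleConic : MvPolynomial (Fin 2) ℂ :=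
  X 0 ^ 2 + C Complex.I * X 1 ^ 2 + X 1

/-! Split the quadratic part of the conic into two complex linear forms. If they are proportional,
or both are proportional to real forms, real affine coordinates turn the conic into a hyperbola, a
parabola, parallel lines, or the square of a nonreal form plus linear terms. In the last case `I(p)`
is the whole plane. In the others elementary algebra describes `I(p)`, and its boundary is algebraic
with components of degree at most two.

Otherwise some factor `α` is not proportional to a real form. For fixed `y = Im z`, the value `ω =
α·z - a₀` then takes every complex value as `Re z` varies, and `z̄ = z - 2iy` lets the other factor
be written through `ω`, `ω̄` and `y`. Up to a nonzero scalar `p(z)` becomes `ω ω̄ + a ω² + τ ω + γ`,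
where `τ` is an affine complex coordinate on the `y`-plane. So `I(p)` is the set of `τ` for which
this equation is solvable. If `γ = 0`, take `ω = 0`. If `|a| = 1`, every `τ` off one line is
admissible. If `|a| ≠ 1` the set is closed, and its boundary consists of critical values of `ω ↦
-(ω̄ + a ω + γ/ω)`. On these the discriminant of a binary cubic vanishes; it has degree four in
coefficients of degree at most two in `τ`, which gives `8`.

In this second family every large `τ` is admissible, so the complement is bounded. If it has no
bounded component it is empty, which gives (d). Real coefficients force `a = 0`, and the boundary is
then a circle or empty.

For the sharp example the discriminant is `64` times an explicit octic that is irreducible over `ℂ`.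
The boundary is infinite, so the octic generates its vanishing ideal. A non-algebraic boundary comes
from a conic whose boundary contains a segment of a line but not the whole line. -/

/-! ### Plane real curves: finite intersections and degrees of components -/

/-- Elimination of one variable. By Gauss's lemma `f` stays irreducible over the fraction field,
hence is coprime to `g` there; denominators are cleared in the Bézout identity. -/
theorem exists_C_eq_combination_of_not_dvd {A : Type*} [CommRing A] [IsDomain A]
    [UniqueFactorizationMonoid A] {f g : Polynomial A} (hf : Irreducible f) (hfg : ¬ f ∣ g) :
    ∃ h : A, h ≠ 0 ∧ ∃ u v : Polynomial A, Polynomial.C h = u * f + v * g := by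
  classical
  let _ : NormalizedGCDMonoid A := Classical.choice inferInstance
  by_cases h0 : f.natDegree = 0
  · obtain ⟨c, hc⟩ := Polynomial.natDegree_eq_zero.1 h0
    refine ⟨c, ?_, 1, 0, by simp [hc]⟩
    rintro rfl
    exact hf.ne_zero (by simp [← hc])
  let K := FractionRing A
  have hprim := hf.isPrimitive h0
  have hfK : Irreducible (f.map (algebraMap A K)) :=
    (hprim.irreducible_iff_irreducible_map_fraction_map (K := K)).1 hf
  have hinj : Function.Injective (Polynomial.map (algebraMap A K)) :=
    Polynomial.map_injective _ (IsFractionRing.injective A K)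
  have hdvd : ¬ f.map (algebraMap A K) ∣ g.map (algebraMap A K) := by
    rintro ⟨q, hq⟩
    obtain ⟨d, hd, hdq⟩ := IsLocalization.integerNormalization_spec (nonZeroDivisors A) q
    have hd0 : d ≠ 0 := nonZeroDivisors.ne_zero hd
    have key : Polynomial.C d * g = f *
        IsLocalization.integerNormalization (nonZeroDivisors A) q := by
      apply hinj
      rw [Polynomial.map_mul, Polynomial.map_mul, hdq, hq, Polynomial.map_C, Algebra.smul_def,
        Polynomial.algebraMap_apply]
      ring
    rcases hf.prime.dvd_or_dvd (Dvd.intro _ key.symm) with h | h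
    · have := Polynomial.natDegree_le_of_dvd h (by simpa using hd0)
      simp at this
      exact h0 this
    · exact hfg h
  obtain ⟨u, v, huv⟩ := (hfK.coprime_iff_not_dvd).2 hdvd
  obtain ⟨d, hd, hdu⟩ := IsLocalization.integerNormalization_spec (nonZeroDivisors A) u
  obtain ⟨e, he, hev⟩ := IsLocalization.integerNormalization_spec (nonZeroDivisors A) v
  refine ⟨d * e, mul_ne_zero (nonZeroDivisors.ne_zero hd) (nonZeroDivisors.ne_zero he),
    Polynomial.C e * IsLocalization.integerNormalization (nonZeroDivisors A) u,
    Polynomial.C d * IsLocalization.integerNormalization (nonZeroDivisors A) v, ?_⟩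
  apply hinj
  simp only [Polynomial.map_add, Polynomial.map_mul, hdu, hev, Polynomial.map_C, Algebra.smul_def,
    Polynomial.algebraMap_apply, map_mul]
  linear_combination (-1 : Polynomial K) * Polynomial.C (algebraMap A K d) *
    Polynomial.C (algebraMap A K e) * huv

/-- Eliminating `X 0` leaves a nonzero polynomial in `X 1` that vanishes at the second coordinate of
each common zero. -/
theorem finite_image_one_of_not_dvd {f g : MvPolynomial (Fin 2) ℝ} (hf : Irreducible f)
    (hfg : ¬ f ∣ g) :
    ((fun y : Fin 2 → ℝ => y 1) '' {y | eval y f = 0 ∧ eval y g = 0}).Finite := by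
  let Φ := MvPolynomial.finSuccEquiv ℝ 1
  have hf' : Irreducible (Φ f) := (MulEquiv.irreducible_iff Φ.toMulEquiv).2 hf
  have hfg' : ¬ Φ f ∣ Φ g := fun h => hfg ((map_dvd_iff Φ.toMulEquiv).1 h)
  obtain ⟨h, h0, u, v, huv⟩ := exists_C_eq_combination_of_not_dvd hf' hfg'
  by_contra hinf
  apply h0
  refine MvPolynomial.funext_set (fun _ => _) (fun _ => hinf) ?_
  intro s hs
  obtain ⟨y, ⟨hyf, hyg⟩, hy⟩ := hs 0 (Set.mem_univ _)
  have hcons : y = Fin.cons (y 0) s := by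
    funext i
    fin_cases i
    · rfl
    · exact hy
  rw [hcons, eval_eq_eval_mv_eval'] at hyf hyg
  have := congrArg (fun P => Polynomial.eval (y 0) (Polynomial.map (eval s) P)) huv
  simp only [Polynomial.map_C, Polynomial.eval_C, Polynomial.map_add, Polynomial.map_mul,
    Polynomial.eval_add, Polynomial.eval_mul] at this
  rw [this, map_zero]
  simp only [Φ, hyf, hyg]
  simp

theorem finite_commonZeros_of_not_dvd {f g : MvPolynomial (Fin 2) ℝ} (hf : Irreducible f)
    (hfg : ¬ f ∣ g) : {y : Fin 2 → ℝ | eval y f = 0 ∧ eval y g = 0}.Finite := by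
  have h1 := finite_image_one_of_not_dvd hf hfg
  -- Swapping the variables bounds the other coordinate as well.
  let σ := Equiv.swap (0 : Fin 2) 1
  let Ψ := MvPolynomial.renameEquiv ℝ σ
  have hf' : Irreducible (Ψ f) := (MulEquiv.irreducible_iff Ψ.toMulEquiv).2 hf
  have hfg' : ¬ Ψ f ∣ Ψ g := fun h => hfg ((map_dvd_iff Ψ.toMulEquiv).1 h)
  have h0 := finite_image_one_of_not_dvd hf' hfg'
  have hsub : (fun y : Fin 2 → ℝ => y 0) '' {y | eval y f = 0 ∧ eval y g = 0} ⊆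
      (fun y : Fin 2 → ℝ => y 1) '' {y | eval y (Ψ f) = 0 ∧ eval y (Ψ g) = 0} := by
    rintro _ ⟨y, ⟨hyf, hyg⟩, rfl⟩
    refine ⟨y ∘ σ, ⟨?_, ?_⟩, by simp [σ]⟩
    all_goals
      simp only [Ψ, renameEquiv_apply, eval_rename]
      have : (y ∘ σ) ∘ σ = y := by funext i; simp [σ]
      rwa [this]
  refine Set.Finite.subset (Set.Finite.pi' (t := fun i : Fin 2 => (fun y : Fin 2 → ℝ => y i) ''
    {y | eval y f = 0 ∧ eval y g = 0}) ?_) ?_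
  · intro i
    fin_cases i
    · exact h0.subset hsub
    · exact h1
  · intro y hy i
    exact ⟨y, hy, rfl⟩

theorem vanishingIdeal_isPrime_of_irreducible {n : ℕ} {Z : Set (Fin n → ℝ)}
    (hZ : IsIrreducibleAlgebraicSet Z) : (vanishingIdeal ℝ Z).IsPrime := by
  obtain ⟨⟨I, hI⟩, ⟨a, ha⟩, hirr⟩ := hZ
  have halg : ∀ g : MvPolynomial (Fin n) ℝ, IsAlgebraicSet (Z ∩ {y | aeval y g = 0}) := by
    intro g
    refine ⟨I ⊔ Ideal.span {g}, ?_⟩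
    rw [(zeroLocus_vanishingIdeal_galoisConnection (k := ℝ) (K := ℝ)).l_sup, zeroLocus_span, ← hI]
    simp
    rfl
  refine ⟨?_, ?_⟩
  · intro htop
    have : (1 : MvPolynomial (Fin n) ℝ) ∈ vanishingIdeal ℝ Z := by rw [htop]; trivial
    simpa using this a ha
  · intro g h hgh
    have hun : Z = (Z ∩ {y | aeval y g = 0}) ∪ (Z ∩ {y | aeval y h = 0}) := by
      ext y
      constructor
      · intro hy
        have := hgh y hy
        rw [map_mul, mul_eq_zero] at this
        exact this.imp (fun h => ⟨hy, h⟩) (fun h => ⟨hy, h⟩)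
      · rintro (h | h) <;> exact h.1
    rcases hirr _ _ (halg g) (halg h) hun with h' | h'
    · left; intro y hy; rw [h'] at hy; exact hy.2
    · right; intro y hy; rw [h'] at hy; exact hy.2

/-- The product of `X i - c i` over the points `c` of `Z` lies in the prime ideal, so one factor
does, and the `i`-th coordinate is constant on `Z`. -/
theorem eq_of_finite_of_isPrime_vanishingIdeal {n : ℕ} {Z : Set (Fin n → ℝ)} (hfin : Z.Finite)
    (hp : (vanishingIdeal ℝ Z).IsPrime) {a b : Fin n → ℝ} (ha : a ∈ Z) (hb : b ∈ Z) : a = b := by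
  funext i
  have hmem : ∏ c ∈ hfin.toFinset, (X i - C (c i) : MvPolynomial (Fin n) ℝ) ∈
      vanishingIdeal ℝ Z := by
    intro y hy
    rw [map_prod]
    exact Finset.prod_eq_zero (hfin.mem_toFinset.2 hy) (by simp)
  obtain ⟨c, -, hc⟩ := (hp.prod_mem_iff).1 hmem
  have h1 := hc a ha
  have h2 := hc b hb
  simp only [map_sub, aeval_X, algHom_C, Algebra.algebraMap_self, RingHom.id_apply] at h1 h2
  linarith

/-- `S` lies on a plane curve all of whose irreducible factors have degree at most `d`. -/
def LiesOnCurve (S : Set (Fin 2 → ℝ)) (d : ℕ) : Prop :=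
  ∃ F : MvPolynomial (Fin 2) ℝ, F ≠ 0 ∧
    (∀ f : MvPolynomial (Fin 2) ℝ, Irreducible f → f ∣ F → f.totalDegree ≤ d) ∧
    ∀ y ∈ S, eval y F = 0

theorem LiesOnCurve.zariskiClosure_ne_univ {S : Set (Fin 2 → ℝ)} {d : ℕ}
    (h : LiesOnCurve S d) : zariskiClosure S ≠ Set.univ := by
  obtain ⟨F, hF, -, hS⟩ := h
  intro huniv
  apply hF
  refine MvPolynomial.funext fun y => ?_
  have : y ∈ zariskiClosure S := huniv ▸ Set.mem_univ y
  simpa using this F (fun z hz => by simpa using hS z hz)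

/-- The ideal of a component is prime and contains `F`, hence an irreducible factor `f` of `F`.
Either `f` generates it, or a further element not divisible by `f` makes the component finite, hence
a point; `1 ≤ d` covers that case. -/
theorem LiesOnCurve.componentsHaveDegreeAtMost {S : Set (Fin 2 → ℝ)} {d : ℕ} (hd : 1 ≤ d)
    (h : LiesOnCurve S d) : ComponentsHaveDegreeAtMost S d := by
  obtain ⟨F, hF, hdeg, hS⟩ := h
  rintro Z ⟨⟨hirr, hZ⟩, -⟩
  have hp := vanishingIdeal_isPrime_of_irreducible hirr
  have hFZ : F ∈ vanishingIdeal ℝ Z := fun y hy =>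
    hZ hy F (fun z hz => by simpa using hS z hz)
  obtain ⟨f, hfF, hfirr, hfZ⟩ : ∃ f, f ∣ F ∧ Irreducible f ∧ f ∈ vanishingIdeal ℝ Z := by
    obtain ⟨s, hs, u, hu⟩ := WfDvdMonoid.exists_factors F hF
    rw [← hu] at hFZ
    have : s.prod ∈ vanishingIdeal ℝ Z := (hp.mem_or_mem hFZ).resolve_right
      fun h => hp.ne_top (Ideal.eq_top_of_isUnit_mem _ h u.isUnit)
    obtain ⟨f, hfs, hf⟩ := (hp.multiset_prod_mem_iff_exists_mem s).1 this
    exact ⟨f, hu ▸ (Multiset.dvd_prod hfs).mul_right _, hs f hfs, hf⟩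
  by_cases heq : vanishingIdeal ℝ Z = Ideal.span {f}
  · exact ⟨f.totalDegree, hdeg f hfirr hfF, Or.inr ⟨f, hfirr, heq, rfl⟩⟩
  · obtain ⟨g, hg, hfg⟩ : ∃ g ∈ vanishingIdeal ℝ Z, ¬ f ∣ g := by
      by_contra! hcon
      exact heq (le_antisymm (fun g hg => Ideal.mem_span_singleton.2 (hcon g hg))
        ((Ideal.span_singleton_le_iff_mem _).2 hfZ))
    have hfin : Z.Finite := (finite_commonZeros_of_not_dvd hfirr hfg).subset
      fun y hy => ⟨by simpa using hfZ y hy, by simpa using hg y hy⟩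
    obtain ⟨a, ha⟩ := hirr.2.1
    refine ⟨1, hd, Or.inl ⟨Or.inl ⟨a, ?_⟩, rfl⟩⟩
    exact Set.eq_singleton_iff_unique_mem.2
      ⟨ha, fun b hb => eq_of_finite_of_isPrime_vanishingIdeal hfin hp hb ha⟩

theorem LiesOnCurve.mono {S T : Set (Fin 2 → ℝ)} {d e : ℕ} (h : LiesOnCurve T d) (hST : S ⊆ T)
    (hde : d ≤ e) : LiesOnCurve S e := by
  obtain ⟨F, hF, hdeg, hS⟩ := h
  exact ⟨F, hF, fun f hf hfF => (hdeg f hf hfF).trans hde, fun y hy => hS y (hST hy)⟩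

theorem LiesOnCurve.union {S T : Set (Fin 2 → ℝ)} {d : ℕ} (hS : LiesOnCurve S d)
    (hT : LiesOnCurve T d) : LiesOnCurve (S ∪ T) d := by
  obtain ⟨F, hF, hFd, hFS⟩ := hS
  obtain ⟨G, hG, hGd, hGT⟩ := hT
  refine ⟨F * G, mul_ne_zero hF hG, fun f hf hfd => ?_, ?_⟩
  · exact (hf.prime.dvd_or_dvd hfd).elim (hFd f hf) (hGd f hf)
  · rintro y (hy | hy) <;> simp [hFS, hGT, hy]

theorem liesOnCurve_empty (d : ℕ) : LiesOnCurve ∅ d :=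
  ⟨1, one_ne_zero, fun _ hf h => absurd (isUnit_of_dvd_one h) hf.not_isUnit, by simp⟩

/-- `f` is given by a real polynomial of total degree at most `d`. -/
def IsPolyFun (d : ℕ) (f : (Fin 2 → ℝ) → ℝ) : Prop :=
  ∃ P : MvPolynomial (Fin 2) ℝ, P.totalDegree ≤ d ∧ ∀ y, eval y P = f y

namespace IsPolyFun

variable {d e : ℕ} {f g : (Fin 2 → ℝ) → ℝ}

theorem const (c : ℝ) : IsPolyFun d fun _ => c :=
  ⟨C c, by simp, by simp⟩

theorem coord (i : Fin 2) : IsPolyFun 1 fun y => y i :=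
  ⟨X i, by simp [totalDegree_X], by simp⟩

theorem mono (hf : IsPolyFun d f) (h : d ≤ e) : IsPolyFun e f := by
  obtain ⟨P, hP, hPf⟩ := hf
  exact ⟨P, hP.trans h, hPf⟩

theorem add (hf : IsPolyFun d f) (hg : IsPolyFun d g) : IsPolyFun d fun y => f y + g y := by
  obtain ⟨P, hP, hPf⟩ := hf
  obtain ⟨Q, hQ, hQg⟩ := hg
  exact ⟨P + Q, (totalDegree_add _ _).trans (max_le hP hQ), by simp [hPf, hQg]⟩

theorem mul (hf : IsPolyFun d f) (hg : IsPolyFun e g) : IsPolyFun (d + e) fun y => f y * g y := by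
  obtain ⟨P, hP, hPf⟩ := hf
  obtain ⟨Q, hQ, hQg⟩ := hg
  exact ⟨P * Q, (totalDegree_mul _ _).trans (add_le_add hP hQ), by simp [hPf, hQg]⟩

theorem const_mul (c : ℝ) (hf : IsPolyFun d f) : IsPolyFun d fun y => c * f y := by
  simpa using (const (d := 0) c).mul hf

theorem sub (hf : IsPolyFun d f) (hg : IsPolyFun d g) : IsPolyFun d fun y => f y - g y := by
  simpa [sub_eq_add_neg] using hf.add (hg.const_mul (-1))

theorem pow (hf : IsPolyFun d f) (n : ℕ) : IsPolyFun (n * d) fun y => f y ^ n := by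
  obtain ⟨P, hP, hPf⟩ := hf
  exact ⟨P ^ n, (totalDegree_pow _ _).trans (Nat.mul_le_mul_left n hP), by simp [hPf]⟩

theorem liesOnCurve {S : Set (Fin 2 → ℝ)} (hf : IsPolyFun d f) {y₀ : Fin 2 → ℝ} (h0 : f y₀ ≠ 0)
    (hS : ∀ y ∈ S, f y = 0) : LiesOnCurve S d := by
  obtain ⟨P, hP, hPf⟩ := hf
  have hP0 : P ≠ 0 := by
    rintro rfl
    exact h0 (by simp [← hPf])
  exact ⟨P, hP0, fun g _ hgP => (totalDegree_le_of_dvd_of_isDomain hgP hP0).trans hP,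
    fun y hy => by rw [hPf, hS y hy]⟩

theorem isAlgebraicSet (hf : IsPolyFun d f) : IsAlgebraicSet {y | f y = 0} := by
  obtain ⟨P, -, hPf⟩ := hf
  refine ⟨Ideal.span {P}, ?_⟩
  rw [zeroLocus_span]
  ext y
  simp [hPf]

theorem isAlgebraicSet_and (hf : IsPolyFun d f) (hg : IsPolyFun e g) :
    IsAlgebraicSet {y | f y = 0 ∧ g y = 0} := by
  obtain ⟨P, -, hPf⟩ := hf
  obtain ⟨Q, -, hQg⟩ := hg
  refine ⟨Ideal.span {P, Q}, ?_⟩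
  rw [zeroLocus_span]
  ext y
  simp [hPf, hQg]

end IsPolyFun

theorem isAlgebraicSet_empty {n : ℕ} : IsAlgebraicSet (∅ : Set (Fin n → ℝ)) :=
  ⟨⊤, by simp⟩

theorem vanishingIdeal_zariskiClosure {n : ℕ} (S : Set (Fin n → ℝ)) :
    vanishingIdeal ℝ (zariskiClosure S) = vanishingIdeal ℝ S :=
  le_antisymm (vanishingIdeal_anti_mono (zeroLocus_vanishingIdeal_le S))
    (le_vanishingIdeal_zeroLocus _)

theorem isIrreducibleAlgebraicSet_zariskiClosure {n : ℕ} {S : Set (Fin n → ℝ)}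
    (h : (vanishingIdeal ℝ S).IsPrime) : IsIrreducibleAlgebraicSet (zariskiClosure S) := by
  refine ⟨⟨_, rfl⟩, ?_, ?_⟩
  · by_contra hne
    rw [Set.not_nonempty_iff_eq_empty] at hne
    apply h.ne_top
    rw [← vanishingIdeal_zariskiClosure, hne, vanishingIdeal_empty]
  · rintro V₁ V₂ ⟨I₁, rfl⟩ ⟨I₂, rfl⟩ hun
    have hmul : I₁ * I₂ ≤ vanishingIdeal ℝ S := by
      rw [← vanishingIdeal_zariskiClosure, hun]
      refine Ideal.mul_le.2 fun f hf g hg y hy => ?_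
      rcases hy with hy | hy
      · simpa using Or.inl (hy f hf)
      · simpa using Or.inr (hy g hg)
    rcases h.mul_le.1 hmul with h1 | h2
    · left
      exact le_antisymm (zeroLocus_anti_mono h1) (hun ▸ Set.subset_union_left)
    · right
      exact le_antisymm (zeroLocus_anti_mono h2) (hun ▸ Set.subset_union_right)

/-- An infinite subset determines an irreducible curve, since a polynomial not divisible by `F` has
only finitely many zeros in common with it. -/
theorem vanishingIdeal_eq_span_of_infinite {S : Set (Fin 2 → ℝ)} {F : MvPolynomial (Fin 2) ℝ}
    (hF : Irreducible F) (hS : S.Infinite) (hFS : ∀ y ∈ S, eval y F = 0) :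
    vanishingIdeal ℝ S = Ideal.span {F} := by
  refine le_antisymm (fun g hg => Ideal.mem_span_singleton.2 ?_)
    ((Ideal.span_singleton_le_iff_mem _).2 fun y hy => by simpa using hFS y hy)
  by_contra hdvd
  exact hS ((finite_commonZeros_of_not_dvd hF hdvd).subset
    fun y hy => ⟨hFS y hy, by simpa using hg y hy⟩)

/-! ### Irreducibility of the octic -/

/-- A square root would be integral, hence in `A`, where `π` divides a square to an even power and
not exactly three times. -/
theorem not_isSquare_algebraMap_of_prime_cube {A K : Type*} [CommRing A] [IsDomain A]
    [IsIntegrallyClosed A] [Field K] [Algebra A K] [IsFractionRing A K] {π m : A} (hπ : Prime π)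
    (hm : ¬ π ∣ m) (b : K) : b ^ 2 ≠ algebraMap A K (π ^ 3 * m) := by
  intro hb
  have hint : IsIntegral A b := by
    refine IsIntegral.of_pow (n := 2) (by norm_num) ?_
    rw [hb]
    exact isIntegral_algebraMap
  obtain ⟨c, rfl⟩ := IsIntegrallyClosed.isIntegral_iff.1 hint
  rw [← map_pow] at hb
  have hc : c ^ 2 = π ^ 3 * m := IsFractionRing.injective A K hb
  obtain ⟨d, rfl⟩ : π ∣ c := hπ.dvd_of_dvd_pow (n := 2) ⟨π ^ 2 * m, by rw [hc]; ring⟩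
  have hd : d ^ 2 = π * m := by
    apply mul_left_cancel₀ (pow_ne_zero 2 hπ.ne_zero)
    linear_combination hc
  obtain ⟨e, rfl⟩ : π ∣ d := hπ.dvd_of_dvd_pow (n := 2) ⟨m, hd⟩
  exact hm ⟨e ^ 2, by
    apply mul_left_cancel₀ hπ.ne_zero
    linear_combination -hd⟩

open Polynomial in
-- It suffices that a root `x` of `f` is not a square in `K(x)`. If `x = b²`, taking norms makes
-- `±f(0)` the square of the norm of `b`; the even degree fixes the sign.
theorem Polynomial.irreducible_comp_X_sq {K : Type*} [Field K] {f : K[X]} (hfm : f.Monic)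
    (hf : Irreducible f) (heven : Even f.natDegree) (h0 : ∀ b : K, b ^ 2 ≠ f.coeff 0) :
    Irreducible (f.comp (X ^ 2)) := by
  refine irreducible_comp hfm (monic_X_pow 2) hf ?_
  intro E _ _ x hx
  have hint : IsIntegral K x := by
    by_contra h
    rw [minpoly.eq_zero h] at hx
    exact hf.ne_zero hx.symm
  rw [Polynomial.map_pow, map_X]
  refine X_pow_sub_C_irreducible_of_prime Nat.prime_two fun b hb => ?_
  apply h0 (Algebra.norm K b)
  rw [← map_pow, hb, ← IntermediateField.adjoin.powerBasis_gen hint,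
    Algebra.PowerBasis.norm_gen_eq_coeff_zero_minpoly, IntermediateField.adjoin.powerBasis_gen,
    IntermediateField.adjoin.powerBasis_dim, IntermediateField.minpoly_gen, hx, heven.neg_one_pow,
    one_mul]

open Polynomial in
-- Substituting `X²` twice into `X² + bX + c` keeps the constant term `c` and the even degree, so
-- one condition on `c` serves both steps.
theorem Polynomial.irreducible_quadratic_comp_X_pow_four {K : Type*} [Field K] {b c : K}
    (hdisc : ∀ r : K, r ^ 2 ≠ b ^ 2 - 4 * c) (hc : ∀ r : K, r ^ 2 ≠ c) :
    Irreducible (X ^ 8 + C b * X ^ 4 + C c : K[X]) := by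
  let q : K[X] := X ^ 2 + C b * X + C c
  have hq2 : q.natDegree = 2 := by simp only [q]; compute_degree!
  have hqm : q.Monic := by simp only [q]; monicity!
  have hq0 : q.coeff 0 = c := by simp [q]
  have hqi : Irreducible q := by
    rw [irreducible_iff_roots_eq_zero_of_degree_le_three (by omega) (by omega)]
    refine Multiset.eq_zero_of_forall_notMem fun r hr => ?_
    have := (mem_roots'.1 hr).2
    simp only [q, IsRoot.def, eval_add, eval_pow, eval_X, eval_mul, eval_C] at this
    exact hdisc (2 * r + b) (by linear_combination 4 * this)
  have h1 : Irreducible (q.comp (X ^ 2)) :=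
    irreducible_comp_X_sq hqm hqi (by rw [hq2]; exact even_two) (by rwa [hq0])
  have h2 : Irreducible ((q.comp (X ^ 2)).comp (X ^ 2)) := by
    refine irreducible_comp_X_sq (hqm.comp (monic_X_pow 2) (by simp)) h1 ?_ ?_
    · rw [natDegree_comp, hq2, natDegree_X_pow]; exact even_two.mul_left 2
    · have : (q.comp (X ^ 2)).coeff 0 = c := by
        rw [coeff_zero_eq_eval_zero, eval_comp]; simp [q]
      rwa [this]
  convert h2 using 1
  simp only [q, add_comp, mul_comp, C_comp, X_comp, pow_comp]
  ring

/-- The polynomial of degree eight that defines the boundary curve of `exampleConic`. -/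
noncomputable def exampleOctic (k : Type*) [Field k] : MvPolynomial (Fin 2) k :=
  X 0 ^ 8 + (C 2 * (X 1 - C (1 / 2)) ^ 4 + C (5 / 4) * (X 1 - C (1 / 2)) ^ 2 - C (1 / 64)) *
    X 0 ^ 4 + (X 1 - C (1 / 2)) ^ 2 * ((X 1 - C (1 / 2)) ^ 2 - C (1 / 4)) ^ 3

theorem map_exampleOctic :
    MvPolynomial.map (algebraMap ℝ ℂ) (exampleOctic ℝ) = exampleOctic ℂ := by
  simp [exampleOctic]

/-- The octic is a monic quadratic in `X 0 ^ 4` over `ℂ[X 1]`. Its discriminant and its constant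
term each have a root of multiplicity exactly three, so neither is a square in `ℂ(X 1)`. -/
theorem irreducible_exampleOctic : Irreducible (exampleOctic ℂ) := by
  let Φ := (MvPolynomial.finSuccEquiv ℂ 1).trans
    (Polynomial.mapAlgEquiv (MvPolynomial.uniqueAlgEquiv ℂ (Fin 1)))
  rw [← MulEquiv.irreducible_iff Φ.toMulEquiv]
  let x : Polynomial ℂ := Polynomial.X
  let V : Polynomial ℂ := (x - Polynomial.C (1 / 2)) ^ 2
  let B : Polynomial ℂ := Polynomial.C 2 * V ^ 2 + Polynomial.C (5 / 4) * V - Polynomial.C (1 / 64)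
  let D : Polynomial ℂ := V * (V - Polynomial.C (1 / 4)) ^ 3
  have hΦ : Φ.toMulEquiv (exampleOctic ℂ) =
      Polynomial.X ^ 8 + Polynomial.C B * Polynomial.X ^ 4 + Polynomial.C D := by
    have hX0 : Φ (X 0) = Polynomial.X := by simp [Φ, MvPolynomial.finSuccEquiv_apply]
    have hX1 : Φ (X 1) = Polynomial.C x := by
      have : MvPolynomial.finSuccEquiv ℂ 1 (X 1) = Polynomial.C (X 0) :=
        MvPolynomial.finSuccEquiv_X_succ (j := 0)
      simp [Φ, this, x]
    have hC : ∀ c : ℂ, Φ (C c) = Polynomial.C (Polynomial.C c) := fun c => by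
      simp [Φ, MvPolynomial.finSuccEquiv_apply]
    change Φ (exampleOctic ℂ) = _
    simp only [exampleOctic, map_add, map_mul, map_sub, map_pow, hX0, hX1, hC, B, D, V]
    ring
  rw [hΦ]
  have hmon : (Polynomial.X ^ 8 + Polynomial.C B * Polynomial.X ^ 4 + Polynomial.C D :
      Polynomial (Polynomial ℂ)).Monic := by monicity!
  rw [hmon.irreducible_iff_irreducible_map_fraction_map (K := FractionRing (Polynomial ℂ))]
  simp only [Polynomial.map_add, Polynomial.map_mul, Polynomial.map_pow, Polynomial.map_C,
    Polynomial.map_X]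
  apply Polynomial.irreducible_quadratic_comp_X_pow_four
  · intro r
    -- The discriminant is `8 (V + 1/32)³`, whose roots in `x` are `1/2 ± c`.
    obtain ⟨c, hc⟩ := IsAlgClosed.exists_pow_nat_eq (-1 / 32 : ℂ) (n := 2) (by norm_num)
    have hc0 : c ≠ 0 := by rintro rfl; norm_num at hc
    have hfac : B ^ 2 - 4 * D = (x - Polynomial.C (1 / 2 + c)) ^ 3 *
        (8 * (x - Polynomial.C (1 / 2 - c)) ^ 3) := by
      refine Polynomial.funext fun t => ?_
      simp only [B, D, V, x, Polynomial.eval_sub, Polynomial.eval_mul, Polynomial.eval_pow,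
        Polynomial.eval_add, Polynomial.eval_X, Polynomial.eval_C, Polynomial.eval_ofNat]
      have : (t - (1 / 2 + c)) ^ 3 * (8 * (t - (1 / 2 - c)) ^ 3) =
          8 * ((t - 1 / 2) ^ 2 - c ^ 2) ^ 3 := by ring
      rw [this, hc]
      ring
    have := not_isSquare_algebraMap_of_prime_cube (K := FractionRing (Polynomial ℂ))
      (Polynomial.prime_X_sub_C (1 / 2 + c)) (m := 8 * (x - Polynomial.C (1 / 2 - c)) ^ 3) ?_ r
    · rwa [← hfac, map_sub, map_mul, map_pow, map_ofNat] at this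
    · rw [Polynomial.dvd_iff_isRoot]
      simp only [x, Polynomial.IsRoot.def, Polynomial.eval_mul, Polynomial.eval_pow,
        Polynomial.eval_sub, Polynomial.eval_X, Polynomial.eval_C, Polynomial.eval_ofNat]
      have : 1 / 2 + c - (1 / 2 - c) = 2 * c := by ring
      rw [this]
      simp [hc0]
  · intro r
    have hfac : D = (x - Polynomial.C 0) ^ 3 * (V * (x - 1) ^ 3) := by
      refine Polynomial.funext fun t => ?_
      simp only [D, V, x, Polynomial.eval_sub, Polynomial.eval_mul, Polynomial.eval_pow,
        Polynomial.eval_X, Polynomial.eval_C, Polynomial.eval_one]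
      ring
    rw [hfac]
    apply not_isSquare_algebraMap_of_prime_cube (Polynomial.prime_X_sub_C 0)
    rw [Polynomial.dvd_iff_isRoot]
    simp [V, x]

theorem totalDegree_exampleOctic : (exampleOctic ℝ).totalDegree = 8 := by
  apply le_antisymm
  · have h1 : (X 1 - C (1 / 2) : MvPolynomial (Fin 2) ℝ).totalDegree ≤ 1 :=
      (totalDegree_sub _ _).trans (by simp [totalDegree_X])
    have hp : ∀ n, ((X 1 - C (1 / 2) : MvPolynomial (Fin 2) ℝ) ^ n).totalDegree ≤ n := fun n =>
      (totalDegree_pow _ _).trans (by nlinarith)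
    have hX : ∀ n, ((X 0 : MvPolynomial (Fin 2) ℝ) ^ n).totalDegree ≤ n := fun n =>
      (totalDegree_pow _ _).trans (by simp [totalDegree_X])
    have hCm : ∀ (c : ℝ) n, (C c * (X 1 - C (1 / 2) : MvPolynomial (Fin 2) ℝ) ^ n).totalDegree ≤ n :=
      fun c n => (totalDegree_mul _ _).trans (by simpa using hp n)
    refine (totalDegree_add _ _).trans (max_le ((totalDegree_add _ _).trans (max_le (hX 8) ?_)) ?_)
    · refine (totalDegree_mul _ _).trans (show _ ≤ 4 + 4 from add_le_add ?_ (hX 4))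
      refine (totalDegree_sub _ _).trans (max_le ((totalDegree_add _ _).trans
        (max_le (hCm _ _) ((hCm _ _).trans (by norm_num)))) (by simp))
    · refine (totalDegree_mul _ _).trans (show _ ≤ 2 + 3 * 2 from add_le_add (hp 2) ?_)
      refine (totalDegree_pow _ _).trans (Nat.mul_le_mul_left 3 ?_)
      exact (totalDegree_sub _ _).trans (max_le (hp 2) (by simp))
  · have hX1 : MvPolynomial.finSuccEquiv ℝ 1 (X 1) = Polynomial.C (X 0) :=
      MvPolynomial.finSuccEquiv_X_succ (j := 0)
    have hC : ∀ c : ℝ, MvPolynomial.finSuccEquiv ℝ 1 (C c) = Polynomial.C (C c) := fun c => by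
      simp [MvPolynomial.finSuccEquiv_apply]
    refine le_trans ?_ (degreeOf_le_totalDegree (exampleOctic ℝ) 0)
    rw [← natDegree_finSuccEquiv]
    simp only [exampleOctic, map_add, map_mul, map_sub, map_pow, hX1, hC,
      MvPolynomial.finSuccEquiv_X_zero]
    simp only [← Polynomial.C_sub, ← Polynomial.C_pow, ← Polynomial.C_mul, ← Polynomial.C_add]
    apply le_of_eq
    symm
    compute_degree!

/-! ### Solvability of the equation in `ω` and `ω̄` -/

open ComplexConjugate Topology

/-- The `τ ∈ ℂ` for which the real quadratic system `ω ω̄ + a ω² + τ ω + γ = 0` is solvable. -/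
def solvableShifts (a γ : ℂ) : Set ℂ :=
  {τ | ∃ ω : ℂ, ω * conj ω + a * ω ^ 2 + τ * ω + γ = 0}

theorem solvableShifts_zero (a : ℂ) : solvableShifts a 0 = Set.univ :=
  Set.eq_univ_of_forall fun _ => ⟨0, by simp⟩

/-- For large `τ` the map `ω ↦ -γ / (a ω + ω̄ + τ)` is a contraction of the unit disc, and its fixed
point solves the equation. -/
theorem mem_solvableShifts_of_large_norm {a γ τ : ℂ} (hτ : ‖γ‖ + 2 * ‖a‖ + 3 ≤ ‖τ‖) :
    τ ∈ solvableShifts a γ := by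
  set m : ℝ := ‖γ‖ + ‖a‖ + 2 with hm
  have hm0 : 0 < m := by positivity
  let d : ℂ → ℂ := fun ω => a * ω + conj ω + τ
  let f : ℂ → ℂ := fun ω => -γ / d ω
  have hd : ∀ ω ∈ Metric.closedBall (0 : ℂ) 1, m ≤ ‖d ω‖ := by
    intro ω hω
    rw [mem_closedBall_zero_iff] at hω
    have h1 : ‖a * ω + conj ω‖ ≤ ‖a‖ + 1 := by
      refine (norm_add_le _ _).trans (add_le_add ?_ (by simpa using hω))
      rw [norm_mul]
      exact mul_le_of_le_one_right (norm_nonneg _) hω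
    have h2 : ‖τ‖ ≤ ‖d ω‖ + ‖a * ω + conj ω‖ := by
      have := norm_sub_le (d ω) (a * ω + conj ω)
      simpa [d] using this
    linarith
  have hd0 : ∀ ω ∈ Metric.closedBall (0 : ℂ) 1, d ω ≠ 0 := fun ω hω =>
    norm_pos_iff.1 (hm0.trans_le (hd ω hω))
  have hmaps : Set.MapsTo f (Metric.closedBall 0 1) (Metric.closedBall 0 1) := by
    intro ω hω
    rw [mem_closedBall_zero_iff, norm_div, norm_neg, div_le_one (hm0.trans_le (hd ω hω))]
    refine le_trans ?_ (hd ω hω)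
    linarith [norm_nonneg a]
  have hcontr : ContractingWith (1 / 2) (hmaps.restrict f _ _) := by
    refine ⟨by rw [div_lt_one] <;> norm_num, LipschitzWith.of_dist_le_mul ?_⟩
    rintro ⟨x, hx⟩ ⟨y, hy⟩
    change dist (f x) (f y) ≤ _ * dist x y
    rw [dist_eq_norm, dist_eq_norm]
    have hxy : f x - f y = γ * (a * (x - y) + conj (x - y)) / (d x * d y) := by
      have hx0 := hd0 x hx
      have hy0 := hd0 y hy
      simp only [f]
      field_simp
      simp only [d, map_sub]
      ring
    rw [hxy, norm_div, norm_mul, norm_mul, div_le_iff₀ (mul_pos (hm0.trans_le (hd x hx))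
      (hm0.trans_le (hd y hy)))]
    have h1 : ‖a * (x - y) + conj (x - y)‖ ≤ (‖a‖ + 1) * ‖x - y‖ := by
      refine (norm_add_le _ _).trans (le_of_eq ?_)
      rw [norm_mul, RCLike.norm_conj]
      ring
    have h2 : m * m ≤ ‖d x‖ * ‖d y‖ := mul_le_mul (hd x hx) (hd y hy) hm0.le (norm_nonneg _)
    have h3 : ‖γ‖ * (‖a‖ + 1) ≤ 1 / 2 * (m * m) := by
      nlinarith [norm_nonneg a, norm_nonneg γ]
    calc ‖γ‖ * ‖a * (x - y) + conj (x - y)‖ ≤ ‖γ‖ * ((‖a‖ + 1) * ‖x - y‖) := by gcongr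
      _ = ‖γ‖ * (‖a‖ + 1) * ‖x - y‖ := by ring
      _ ≤ 1 / 2 * (‖d x‖ * ‖d y‖) * ‖x - y‖ :=
        mul_le_mul_of_nonneg_right (by linarith) (norm_nonneg _)
      _ = _ := by push_cast; ring
  obtain ⟨ω, hω, hfix, -⟩ := hcontr.exists_fixedPoint' Metric.isClosed_closedBall.isComplete hmaps
    (Metric.mem_closedBall_self zero_le_one) (edist_ne_top _ _)
  refine ⟨ω, ?_⟩
  have h : -γ / d ω = ω := hfix
  rw [div_eq_iff (hd0 ω hω)] at h
  simp only [d] at h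
  linear_combination -h

/-- Since `|1 - |a|| |ω|² ≤ |τ ω + γ|`, bounded `τ` have bounded solutions, and a subsequence of
solutions converges. -/
theorem isClosed_solvableShifts {a : ℂ} (γ : ℂ) (ha : ‖a‖ ≠ 1) :
    IsClosed (solvableShifts a γ) := by
  refine IsSeqClosed.isClosed fun τ τ₀ hmem hlim => ?_
  choose ω hω using hmem
  set d : ℝ := |1 - ‖a‖| with hd
  have hd0 : 0 < d := abs_pos.2 (sub_ne_zero.2 (Ne.symm ha))
  obtain ⟨T, hT⟩ := (Metric.isBounded_range_of_tendsto τ hlim).exists_norm_le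
  have hbound : ∀ n, ω n ∈ Metric.closedBall (0 : ℂ) (1 + (T + ‖γ‖) / d) := by
    intro n
    rw [mem_closedBall_zero_iff]
    have hTn := hT (τ n) ⟨n, rfl⟩
    have hT0 : 0 ≤ T := (norm_nonneg _).trans hTn
    have h1 : d * ‖ω n‖ ^ 2 ≤ T * ‖ω n‖ + ‖γ‖ := by
      have e1 : ω n * conj (ω n) + a * ω n ^ 2 = -(τ n * ω n + γ) := by
        linear_combination hω n
      have e2 : ‖ω n * conj (ω n)‖ = ‖ω n‖ ^ 2 := by rw [norm_mul, RCLike.norm_conj, sq]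
      have e3 : ‖a * ω n ^ 2‖ = ‖a‖ * ‖ω n‖ ^ 2 := by rw [norm_mul, norm_pow]
      have e4 := abs_norm_sub_norm_le (ω n * conj (ω n)) (-(a * ω n ^ 2))
      rw [norm_neg, sub_neg_eq_add, e1, norm_neg, e2, e3, ← one_sub_mul, abs_mul,
        abs_of_nonneg (sq_nonneg ‖ω n‖)] at e4
      refine e4.trans ((norm_add_le _ _).trans ?_)
      rw [norm_mul]
      gcongr
    by_cases h : ‖ω n‖ ≤ 1
    · have : 0 ≤ (T + ‖γ‖) / d := by positivity
      linarith
    · push Not at h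
      have : ‖ω n‖ ≤ (T + ‖γ‖) / d := by
        rw [le_div_iff₀ hd0]
        nlinarith [norm_nonneg γ]
      linarith
  obtain ⟨ω₀, -, φ, hφ, hlim'⟩ :=
    tendsto_subseq_of_bounded Metric.isBounded_closedBall hbound
  refine ⟨ω₀, ?_⟩
  have hτ := hlim.comp hφ.tendsto_atTop
  have hc : Filter.Tendsto (fun n => ω (φ n) * conj (ω (φ n)) + a * ω (φ n) ^ 2 +
      τ (φ n) * ω (φ n) + γ) Filter.atTop (𝓝 (ω₀ * conj ω₀ + a * ω₀ ^ 2 + τ₀ * ω₀ + γ)) :=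
    (((hlim'.mul ((Complex.continuous_conj.tendsto _).comp hlim')).add
      ((hlim'.pow 2).const_mul a)).add (hτ.mul hlim')).add_const γ
  simp only [hω] at hc
  exact tendsto_nhds_unique hc tendsto_const_nhds

/-- As `ω ≠ 0`, the equation reads `τ = -(ω̄ + a ω + γ/ω)`. The real differential is `h ↦ -(h̄ + e
h)` with `e = a - γ/ω²`, invertible unless `|e| = 1`; where it is invertible the map is open and `τ`
is interior. -/
theorem exists_critical_of_mem_frontier_solvableShifts {a γ τ : ℂ} (ha : ‖a‖ ≠ 1) (hγ : γ ≠ 0)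
    (hτ : τ ∈ frontier (solvableShifts a γ)) :
    ∃ ω e : ℂ, e * conj e = 1 ∧ γ = ω ^ 2 * (a - e) ∧ τ = -(conj ω + (2 * a - e) * ω) := by
  rw [frontier, (isClosed_solvableShifts γ ha).closure_eq] at hτ
  obtain ⟨⟨ω, hω⟩, hint⟩ := hτ
  have hω0 : ω ≠ 0 := by
    rintro rfl
    exact hγ (by simpa using hω)
  set e : ℂ := a - γ / ω ^ 2 with he
  have hγe : γ = ω ^ 2 * (a - e) := by
    rw [he]
    field_simp
    ring
  have hτω : τ = -(conj ω + a * ω + γ * ω⁻¹) := by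
    field_simp
    linear_combination hω
  refine ⟨ω, e, ?_, hγe, ?_⟩
  swap
  · rw [hτω, hγe]
    field_simp
    ring
  by_contra hne
  apply hint
  have hne' : e * conj e - 1 ≠ 0 := sub_ne_zero.2 hne
  let f : ℂ → ℂ := fun w => -(conj w + a * w + γ * w⁻¹)
  let L : ℂ →L[ℝ] ℂ := -((Complex.conjCLE : ℂ →L[ℝ] ℂ) + a • ContinuousLinearMap.id ℝ ℂ +
    γ • ((ContinuousLinearMap.toSpanSingleton ℂ (-(ω ^ 2)⁻¹)).restrictScalars ℝ))
  have hL : ∀ h, L h = -(conj h + e * h) := by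
    intro h
    simp only [L, he, neg_apply, add_apply,
      smul_apply, ContinuousLinearMap.id_apply, smul_eq_mul,
      ContinuousLinearMap.coe_restrictScalars', ContinuousLinearMap.toSpanSingleton_apply,
      ContinuousLinearEquiv.coe_coe, Complex.conjCLE_apply]
    ring
  have hder : HasStrictFDerivAt f L ω := by
    refine HasStrictFDerivAt.neg (((Complex.conjCLE : ℂ →L[ℝ] ℂ).hasStrictFDerivAt.add
      ((hasStrictFDerivAt_id ω).const_smul a)).add ?_)
    exact ((hasStrictDerivAt_inv hω0).hasStrictFDerivAt.restrictScalars ℝ).const_smul γ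
  have hsurj : L.range = ⊤ := by
    rw [LinearMap.range_eq_top]
    intro w
    -- Found by eliminating `h̄` between `h̄ + e h = -w` and its conjugate.
    refine ⟨-((conj e * w - conj w) / (e * conj e - 1)), ?_⟩
    change L _ = w
    rw [hL]
    have hconj : conj (-((conj e * w - conj w) / (e * conj e - 1))) =
        -((e * conj w - w) / (e * conj e - 1)) := by
      simp only [map_neg, map_div₀, map_sub, map_mul, Complex.conj_conj, map_one]
      rw [mul_comm (conj e) e]
    rw [hconj]
    field_simp
    ring
  have hmap := hder.map_nhds_eq_of_surj hsurj
  have hfω : f ω = τ := hτω.symm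
  rw [hfω] at hmap
  rw [mem_interior_iff_mem_nhds, ← hmap, Filter.mem_map]
  filter_upwards [isOpen_ne.mem_nhds hω0] with w hw
  refine ⟨w, ?_⟩
  simp only [f]
  have : w ≠ 0 := hw
  field_simp
  ring

/-- The middle coefficient of the binary cubic whose discriminant is `shiftDiscriminant`. -/
noncomputable def cubicCoeff (a γ τ : ℂ) : ℂ :=
  τ * conj τ - conj a * τ ^ 2 + (4 * (a * conj a) - 2) * γ - conj γ

/-- The discriminant of the binary cubic `-γ s³ + c s² t + c̄ s t² - γ̄ t³`, where
`c = cubicCoeff a γ τ`. This cubic is the determinant of the pencil spanned by the quadric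
`ω ω̄ + a ω² + τ ω + γ` and its conjugate. -/
noncomputable def shiftDiscriminant (a γ τ : ℂ) : ℝ :=
  Complex.normSq (cubicCoeff a γ τ) ^ 2 + 8 * (γ * conj (cubicCoeff a γ τ) ^ 3).re +
    18 * Complex.normSq γ * Complex.normSq (cubicCoeff a γ τ) - 27 * Complex.normSq γ ^ 2

theorem ofReal_shiftDiscriminant (a γ τ : ℂ) : (shiftDiscriminant a γ τ : ℂ) =
    (cubicCoeff a γ τ * conj (cubicCoeff a γ τ)) ^ 2 +
      4 * (γ * conj (cubicCoeff a γ τ) ^ 3 + conj γ * cubicCoeff a γ τ ^ 3) +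
      18 * (γ * conj γ) * (cubicCoeff a γ τ * conj (cubicCoeff a γ τ)) -
      27 * (γ * conj γ) ^ 2 := by
  have h : (2 * (γ * conj (cubicCoeff a γ τ) ^ 3).re : ℂ) =
      γ * conj (cubicCoeff a γ τ) ^ 3 + conj γ * cubicCoeff a γ τ ^ 3 := by
    have := Complex.add_conj (γ * conj (cubicCoeff a γ τ) ^ 3)
    simp only [map_mul, map_pow, Complex.conj_conj] at this
    rw [this]
    push_cast
    ring
  rw [← h, Complex.mul_conj, Complex.mul_conj, shiftDiscriminant]
  push_cast
  ring

/-- At a critical point the quadric and its conjugate touch, so the determinant of their pencil has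
a double root. The proof substitutes the critical parametrization with `ē = e⁻¹` and checks an
identity. -/
theorem shiftDiscriminant_eq_zero_of_critical {a γ τ ω e : ℂ} (he : e * conj e = 1)
    (hγ : γ = ω ^ 2 * (a - e)) (hτ : τ = -(conj ω + (2 * a - e) * ω)) :
    shiftDiscriminant a γ τ = 0 := by
  have hγ' : conj γ = conj ω ^ 2 * (conj a - conj e) := by rw [hγ]; simp
  have hτ' : conj τ = -(ω + (2 * conj a - conj e) * conj ω) := by
    rw [hτ]
    simp only [map_neg, map_add, map_sub, map_mul, Complex.conj_conj, map_ofNat]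
  have hc : cubicCoeff a γ τ = -2 * ω * conj ω * (a * conj e - 1) -
      ω ^ 2 * (e ^ 2 * conj a - e) := by
    rw [cubicCoeff, hγ', hτ', hτ, hγ]
    linear_combination (ω * conj ω) * he
  have hc' : conj (cubicCoeff a γ τ) = -2 * ω * conj ω * (conj a * e - 1) -
      conj ω ^ 2 * (conj e ^ 2 * a - conj e) := by
    rw [hc]
    simp only [map_sub, map_mul, map_pow, map_neg, Complex.conj_conj, map_one, map_ofNat]
    ring
  have he0 : e ≠ 0 := left_ne_zero_of_mul_eq_one he
  have he' : conj e = e⁻¹ := eq_inv_of_mul_eq_one_right he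
  apply Complex.ofReal_injective
  rw [ofReal_shiftDiscriminant, hc', hc, hγ', hγ, he', Complex.ofReal_zero]
  field_simp
  ring

theorem shiftDiscriminant_eq_zero_of_mem_frontier {a γ τ : ℂ} (ha : ‖a‖ ≠ 1) (hγ : γ ≠ 0)
    (hτ : τ ∈ frontier (solvableShifts a γ)) : shiftDiscriminant a γ τ = 0 := by
  obtain ⟨ω, e, he, hγe, hτe⟩ := exists_critical_of_mem_frontier_solvableShifts ha hγ hτ
  exact shiftDiscriminant_eq_zero_of_critical he hγe hτe

theorem exists_shiftDiscriminant_ne_zero {a : ℂ} (γ : ℂ) (ha : ‖a‖ ≠ 1) :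
    ∃ τ, shiftDiscriminant a γ τ ≠ 0 := by
  set d : ℝ := |1 - ‖a‖| with hd
  have hd0 : 0 < d := abs_pos.2 (sub_ne_zero.2 (Ne.symm ha))
  set k : ℂ := (4 * (a * conj a) - 2) * γ - conj γ with hk
  -- Chosen so that `d r² - ‖k‖`, a lower bound for `‖c‖`, exceeds `3‖γ‖`.
  set r : ℝ := (3 * ‖γ‖ + ‖k‖ + 1) / d + 1 with hr
  have hq : 0 ≤ (3 * ‖γ‖ + ‖k‖ + 1) / d := by positivity
  have hr1 : 1 ≤ r := by linarith
  refine ⟨r, ne_of_gt ?_⟩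
  set c := cubicCoeff a γ r with hc
  have hcn : 3 * ‖γ‖ < ‖c‖ := by
    have h1 : ‖(r : ℂ) * conj (r : ℂ) - conj a * (r : ℂ) ^ 2‖ ≤ ‖c‖ + ‖k‖ := by
      have : (r : ℂ) * conj (r : ℂ) - conj a * (r : ℂ) ^ 2 = c - k := by
        rw [hc, hk, cubicCoeff]
        ring
      rw [this]
      exact norm_sub_le _ _
    have h2 := abs_norm_sub_norm_le ((r : ℂ) * conj (r : ℂ)) (conj a * (r : ℂ) ^ 2)
    have h3 : ‖(r : ℂ) * conj (r : ℂ)‖ = r ^ 2 := by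
      rw [norm_mul, RCLike.norm_conj, Complex.norm_real, Real.norm_of_nonneg (by linarith), sq]
    have h4 : ‖conj a * (r : ℂ) ^ 2‖ = ‖a‖ * r ^ 2 := by
      rw [norm_mul, norm_pow, RCLike.norm_conj, Complex.norm_real,
        Real.norm_of_nonneg (by linarith)]
    rw [h3, h4, ← one_sub_mul, abs_mul, abs_of_nonneg (sq_nonneg r), ← hd] at h2
    have h5 : d * (r - 1) = 3 * ‖γ‖ + ‖k‖ + 1 := by
      rw [hr]
      field_simp
      ring
    have h6 : d * (r - 1) ≤ d * r ^ 2 := by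
      apply mul_le_mul_of_nonneg_left _ hd0.le
      nlinarith
    linarith
  have hre : -(‖γ‖ * ‖c‖ ^ 3) ≤ (γ * conj c ^ 3).re := by
    have := (abs_le.1 (Complex.abs_re_le_norm (γ * conj c ^ 3))).1
    rwa [norm_mul, norm_pow, RCLike.norm_conj] at this
  rw [shiftDiscriminant, ← hc, Complex.normSq_eq_norm_sq, Complex.normSq_eq_norm_sq]
  -- This product is the discriminant with its real part replaced by the lower bound `-‖γ‖‖c‖³`.
  have hpos : 0 < (‖c‖ - 3 * ‖γ‖) ^ 3 * (‖c‖ + ‖γ‖) :=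
    mul_pos (pow_pos (sub_pos.2 hcn) 3) (by linarith [norm_nonneg γ])
  nlinarith

/-- Put `ω = γ / w` with `w = -(ω̄ + ω + τ)`. As `ω + ω̄` is real, `Im w = -Im τ ≠ 0`, and one real
equation for `Re w` remains. Its term `Re (γ / w)` is bounded, so the intermediate value theorem
applies. -/
theorem mem_solvableShifts_one_of_im_ne_zero {γ τ : ℂ} (hτ : τ.im ≠ 0) :
    τ ∈ solvableShifts 1 γ := by
  let w : ℝ → ℂ := fun x => ⟨x, -τ.im⟩
  have hw : ∀ x, |τ.im| ≤ ‖w x‖ := fun x => by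
    simpa [w] using Complex.abs_im_le_norm (w x)
  have hw0 : ∀ x, w x ≠ 0 := fun x => norm_pos_iff.1 ((abs_pos.2 hτ).trans_le (hw x))
  have hwc : Continuous w := by
    have : w = fun x : ℝ => (x : ℂ) + (-τ.im : ℝ) * Complex.I := by
      funext x
      apply Complex.ext <;> simp [w]
    rw [this]
    fun_prop
  let g : ℝ → ℝ := fun x => 2 * (γ / w x).re + τ.re + x
  have hg : Continuous g := by
    have : Continuous fun x => γ / w x := continuous_const.div hwc hw0
    fun_prop
  set M : ℝ := ‖γ‖ / |τ.im| with hM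
  have hbound : ∀ x, |(γ / w x).re| ≤ M := fun x => by
    refine (Complex.abs_re_le_norm _).trans ?_
    rw [norm_div]
    exact div_le_div_of_nonneg_left (norm_nonneg _) (abs_pos.2 hτ) (hw x)
  obtain ⟨x, hx⟩ := mem_range_of_exists_le_of_exists_ge (c := 0) hg
    ⟨-(2 * M + |τ.re|), by
      have := (abs_le.1 (hbound (-(2 * M + |τ.re|)))).2
      simp only [g]
      linarith [le_abs_self τ.re]⟩
    ⟨2 * M + |τ.re|, by
      have := (abs_le.1 (hbound (2 * M + |τ.re|))).1
      simp only [g]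
      linarith [neg_abs_le τ.re]⟩
  have hsum : conj (γ / w x) + γ / w x + τ + w x = 0 := by
    apply Complex.ext
    · simp only [Complex.add_re, Complex.conj_re, Complex.zero_re]
      simp only [g] at hx
      have : (w x).re = x := rfl
      linarith
    · simp only [Complex.add_im, Complex.conj_im, Complex.zero_im]
      have : (w x).im = -τ.im := rfl
      linarith
  refine ⟨γ / w x, ?_⟩
  have hγw : γ = γ / w x * w x := (div_mul_cancel₀ _ (hw0 x)).symm
  linear_combination (γ / w x) * hsum + hγw

theorem mem_solvableShifts_rotate {a γ τ s : ℂ} (hs : s * conj s = 1)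
    (h : τ * conj s ∈ solvableShifts (a * conj s ^ 2) γ) : τ ∈ solvableShifts a γ := by
  obtain ⟨ω, hω⟩ := h
  refine ⟨conj s * ω, ?_⟩
  simp only [map_mul, Complex.conj_conj]
  linear_combination hω + ω * conj ω * hs

/-- Rotating `ω` by a square root of `a` reduces to `a = 1`. -/
theorem exists_im_ne_zero_imp_mem_solvableShifts {a : ℂ} (γ : ℂ) (ha : ‖a‖ = 1) :
    ∃ s : ℂ, s ≠ 0 ∧ ∀ τ, (τ * s).im ≠ 0 → τ ∈ solvableShifts a γ := by
  obtain ⟨s, hs⟩ := IsAlgClosed.exists_pow_nat_eq a (n := 2) (by norm_num)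
  have hs1 : ‖s‖ = 1 := by
    have : ‖s‖ ^ 2 = 1 := by rw [← norm_pow, hs, ha]
    nlinarith [norm_nonneg s]
  have hss : s * conj s = 1 := by
    rw [Complex.mul_conj, Complex.normSq_eq_norm_sq, hs1]
    norm_num
  refine ⟨conj s, right_ne_zero_of_mul_eq_one hss, fun τ hτ => ?_⟩
  apply mem_solvableShifts_rotate hss
  rw [← hs, ← mul_pow, hss, one_pow]
  exact mem_solvableShifts_one_of_im_ne_zero hτ

/-- Taking absolute values in `τ ω = -(t + γ)` with `t = |ω|²` gives `t² - (|τ|² - 2 Re γ) t + |γ|²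
= 0`, which must have a positive root. Conversely a root `t` yields `ω = -(t + γ)/τ`; only `τ = 0`
needs separate treatment. -/
theorem mem_solvableShifts_coeff_zero_iff {γ τ : ℂ} (hγ : γ ≠ 0) :
    τ ∈ solvableShifts 0 γ ↔ 2 * γ.re + 2 * ‖γ‖ ≤ ‖τ‖ ^ 2 := by
  have hγn : 0 < ‖γ‖ := norm_pos_iff.2 hγ
  have hnorm : ∀ t : ℝ, ‖(t : ℂ) + γ‖ ^ 2 = t ^ 2 + 2 * t * γ.re + ‖γ‖ ^ 2 := fun t => by
    rw [← Complex.normSq_eq_norm_sq, ← Complex.normSq_eq_norm_sq, Complex.normSq_apply,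
      Complex.normSq_apply]
    simp
    ring
  constructor
  · rintro ⟨ω, hω⟩
    have hω0 : ω ≠ 0 := by
      rintro rfl
      exact hγ (by simpa using hω)
    have ht : 0 < ‖ω‖ ^ 2 := by positivity
    have h : τ * ω = -(((‖ω‖ ^ 2 : ℝ) : ℂ) + γ) := by
      rw [← Complex.normSq_eq_norm_sq, ← Complex.mul_conj]
      linear_combination hω
    have h2 : ‖τ‖ ^ 2 * ‖ω‖ ^ 2 = ‖ω‖ ^ 2 ^ 2 + 2 * ‖ω‖ ^ 2 * γ.re + ‖γ‖ ^ 2 := by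
      rw [← mul_pow, ← norm_mul, h, norm_neg, hnorm]
      ring
    have h3 : 0 ≤ (‖τ‖ ^ 2 - (2 * γ.re + 2 * ‖γ‖)) * ‖ω‖ ^ 2 := by
      have : (‖τ‖ ^ 2 - (2 * γ.re + 2 * ‖γ‖)) * ‖ω‖ ^ 2 = (‖ω‖ ^ 2 - ‖γ‖) ^ 2 := by
        linear_combination h2
      rw [this]
      exact sq_nonneg _
    linarith [nonneg_of_mul_nonneg_left h3 ht]
  · intro h
    by_cases hτ : τ = 0
    · subst hτ
      rw [norm_zero] at h
      have hre : γ.re = -‖γ‖ := by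
        linarith [(abs_le.1 (Complex.abs_re_le_norm γ)).1]
      have him : γ.im = 0 := by
        have h1 := Complex.normSq_eq_norm_sq γ
        rw [Complex.normSq_apply, hre] at h1
        nlinarith
      refine ⟨(Real.sqrt ‖γ‖ : ℂ), ?_⟩
      rw [Complex.conj_ofReal, ← Complex.ofReal_mul, Real.mul_self_sqrt hγn.le]
      apply Complex.ext <;> simp [hre, him]
    · set S : ℝ := ‖τ‖ ^ 2 - 2 * γ.re with hS
      have hS2 : 2 * ‖γ‖ ≤ S := by linarith
      have hdisc : 0 ≤ S ^ 2 - 4 * ‖γ‖ ^ 2 := by nlinarith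
      set t : ℝ := (S + Real.sqrt (S ^ 2 - 4 * ‖γ‖ ^ 2)) / 2 with ht
      have htq : t ^ 2 - S * t + ‖γ‖ ^ 2 = 0 := by
        have := Real.sq_sqrt hdisc
        rw [ht]
        linear_combination this / 4
      have hτn : ‖τ‖ ^ 2 ≠ 0 := by positivity
      refine ⟨-((t : ℂ) + γ) / τ, ?_⟩
      have hn : -((t : ℂ) + γ) / τ * conj (-((t : ℂ) + γ) / τ) = t := by
        rw [Complex.mul_conj, Complex.normSq_eq_norm_sq, norm_div, norm_neg, div_pow, hnorm]
        congr 1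
        rw [div_eq_iff hτn]
        linear_combination htq
      rw [hn]
      field_simp
      ring

/-- Topologically, `ω²` dominates and the map has degree two. The elementary proof scales `ω` by a
cube root `s` of `m`, which replaces `m` by the real number `|s|²`, and solves the resulting real
system. -/
theorem exists_sq_add_mul_conj_eq (m τ : ℂ) : ∃ ω : ℂ, ω ^ 2 + m * conj ω = τ := by
  obtain ⟨s, hs⟩ := IsAlgClosed.exists_pow_nat_eq m (n := 3) (by norm_num)
  by_cases hs0 : s = 0
  · subst hs0
    obtain ⟨ω, hω⟩ := IsAlgClosed.exists_pow_nat_eq τ (n := 2) (by norm_num)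
    exact ⟨ω, by rw [hω, ← hs]; simp⟩
  set ρ : ℝ := Complex.normSq s with hρ
  have hρ0 : 0 < ρ := Complex.normSq_pos.2 hs0
  suffices h : ∀ A B : ℝ, ∃ x y : ℝ, x ^ 2 - y ^ 2 + ρ * x = A ∧ 2 * x * y - ρ * y = B by
    obtain ⟨x, y, h1, h2⟩ := h (τ / s ^ 2).re (τ / s ^ 2).im
    have h3 : (⟨x, y⟩ : ℂ) ^ 2 + ρ * conj (⟨x, y⟩ : ℂ) = τ / s ^ 2 := by
      apply Complex.ext
      · rw [← h1]; simp [sq]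
      · rw [← h2]; simp [sq]; ring
    refine ⟨s * ⟨x, y⟩, ?_⟩
    rw [hρ, ← Complex.mul_conj, eq_div_iff (pow_ne_zero 2 hs0)] at h3
    rw [map_mul, ← hs]
    linear_combination h3
  intro A B
  by_cases hB : B = 0
  · by_cases hA : A ≤ 3 * ρ ^ 2 / 4
    · refine ⟨ρ / 2, Real.sqrt (3 * ρ ^ 2 / 4 - A), ?_, by rw [hB]; ring⟩
      rw [Real.sq_sqrt (by linarith)]
      ring
    · have hA' : 0 ≤ A + ρ ^ 2 / 4 := by nlinarith
      refine ⟨Real.sqrt (A + ρ ^ 2 / 4) - ρ / 2, 0, ?_, by rw [hB]; ring⟩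
      have := Real.sq_sqrt hA'
      linear_combination this
  -- With `x = ρ/2 + u` the second equation is `2 u y = B`; eliminating `y` from the first leaves `g
  -- u = 0`.
  · let g : ℝ → ℝ := fun u => u ^ 2 * ((ρ / 2 + u) ^ 2 + ρ * (ρ / 2 + u) - A) - B ^ 2 / 4
    have hg : Continuous g := by fun_prop
    set U : ℝ := 1 + |A| + B ^ 2 with hU
    have hU1 : 1 ≤ U := by nlinarith [abs_nonneg A, sq_nonneg B]
    have hgU : 0 ≤ g U := by
      have h1 : B ^ 2 ≤ (ρ / 2 + U) ^ 2 + ρ * (ρ / 2 + U) - A := by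
        nlinarith [le_abs_self A, sq_nonneg B, mul_pos hρ0 hρ0, mul_pos hρ0 (by linarith : 0 < U)]
      have h2 : B ^ 2 ≤ U ^ 2 * ((ρ / 2 + U) ^ 2 + ρ * (ρ / 2 + U) - A) :=
        h1.trans (le_mul_of_one_le_left (le_trans (sq_nonneg B) h1) (one_le_pow₀ hU1))
      simp only [g]
      nlinarith [sq_nonneg B]
    have hg0 : g 0 < 0 := by
      have : 0 < B ^ 2 := by positivity
      simp only [g]
      nlinarith
    obtain ⟨u, ⟨hu0, -⟩, hu⟩ := intermediate_value_Icc (by linarith : (0 : ℝ) ≤ U) hg.continuousOn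
      ⟨hg0.le, hgU⟩
    have hu0' : u ≠ 0 := by
      rintro rfl
      exact hg0.ne hu
    refine ⟨ρ / 2 + u, B / (2 * u), ?_, by field_simp; ring⟩
    simp only [g] at hu
    field_simp
    linear_combination 4 * hu

/-! ### Boundaries of degree at most two in affine coordinates -/

theorem mem_closure_of_path {S : Set ℂ} (c : ℝ → ℂ) (hc : Continuous c) {r : ℝ} (hr : 0 < r)
    (h : ∀ ε, 0 < ε → ε < r → c ε ∈ S) : c 0 ∈ closure S := by
  refine mem_closure_of_tendsto (b := 𝓝[>] (0 : ℝ))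
    ((hc.tendsto 0).mono_left nhdsWithin_le_nhds) ?_
  filter_upwards [Ioo_mem_nhdsGT hr] with ε hε
  exact h ε hε.1 hε.2

/-- A subset of `ℂ = ℝ²` is conical if in all affine coordinates it is algebraic and lies on a
curve with irreducible factors of degree at most two. -/
def IsConicalSet (U : Set ℂ) : Prop :=
  ∀ T : (Fin 2 → ℝ) ≃ₜ ℂ, IsPolyFun 1 (fun y => (T y).re) → IsPolyFun 1 (fun y => (T y).im) →
    IsAlgebraicSet (T ⁻¹' U) ∧ LiesOnCurve (T ⁻¹' U) 2

theorem liesOnCurve_preimage_hyperbola (T : (Fin 2 → ℝ) ≃ₜ ℂ)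
    (hre : IsPolyFun 1 (fun y => (T y).re)) (him : IsPolyFun 1 (fun y => (T y).im)) (c : ℝ) :
    LiesOnCurve (T ⁻¹' {t | t.re * t.im + c = 0}) 2 := by
  refine IsPolyFun.liesOnCurve (f := fun y => (T y).re * (T y).im + c)
    ((hre.mul him).add (.const c)) (y₀ := T.symm ⟨1, 1 - c⟩) ?_ fun y hy => hy
  simp

theorem liesOnCurve_preimage_re (T : (Fin 2 → ℝ) ≃ₜ ℂ)
    (hre : IsPolyFun 1 (fun y => (T y).re)) : LiesOnCurve (T ⁻¹' {t | t.re = 0}) 2 := by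
  refine IsPolyFun.liesOnCurve (f := fun y => (T y).re) (hre.mono one_le_two)
    (y₀ := T.symm 1) ?_ fun y hy => hy
  simp

theorem isConicalSet_empty : IsConicalSet ∅ := fun _ _ _ => by
  rw [Set.preimage_empty]
  exact ⟨isAlgebraicSet_empty, liesOnCurve_empty 2⟩

theorem isConicalSet_circle (R : ℝ) : IsConicalSet {t | ‖t‖ ^ 2 = R} := by
  intro T hre him
  have hf : IsPolyFun 2 fun y => (T y).re ^ 2 + (T y).im ^ 2 - R :=
    ((hre.pow 2).add (him.pow 2)).sub (.const R)
  have heq : T ⁻¹' {t | ‖t‖ ^ 2 = R} = {y | (T y).re ^ 2 + (T y).im ^ 2 - R = 0} := by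
    ext y
    rw [Set.mem_preimage, Set.mem_ofPred_eq, Set.mem_ofPred_eq, ← Complex.normSq_eq_norm_sq,
      Complex.normSq_apply, sub_eq_zero, sq, sq]
  rw [heq]
  refine ⟨hf.isAlgebraicSet, hf.liesOnCurve (y₀ := T.symm ((|R| + 1 : ℝ) : ℂ)) ?_ fun y hy => hy⟩
  simp only [Homeomorph.apply_symm_apply, Complex.ofReal_re, Complex.ofReal_im]
  nlinarith [abs_nonneg R, le_abs_self R]

/-! ### Products of two real lines -/

/-- The imaginary projection of the hyperbola `z₁ z₂ = δ`, in the coordinate `Im z₁ + i Im z₂`. -/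
def hyperbolaProjection (δ : ℂ) : Set ℂ :=
  {t | ∃ x₁ x₂ : ℝ, x₁ * x₂ - t.re * t.im = δ.re ∧ x₁ * t.im + x₂ * t.re = δ.im}

/-- The numbers `x₁ Im t` and `x₂ Re t` have prescribed sum and product, so they are real exactly
when a discriminant is nonnegative. -/
theorem mem_hyperbolaProjection_of_ne_zero {δ t : ℂ} (hu : t.re ≠ 0) (hv : t.im ≠ 0) :
    t ∈ hyperbolaProjection δ ↔
      4 * (t.re * t.im) ^ 2 + 4 * δ.re * (t.re * t.im) - δ.im ^ 2 ≤ 0 := by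
  constructor
  · rintro ⟨x₁, x₂, h1, h2⟩
    rw [← h1, ← h2]
    nlinarith [sq_nonneg (x₁ * t.im - x₂ * t.re)]
  · intro h
    set D := δ.im ^ 2 - 4 * (t.re * t.im) * (t.re * t.im + δ.re) with hD
    have hs : Real.sqrt D ^ 2 = D := Real.sq_sqrt (by rw [hD]; linarith)
    refine ⟨(δ.im + Real.sqrt D) / (2 * t.im), (δ.im - Real.sqrt D) / (2 * t.re), ?_, ?_⟩
    · field_simp
      linear_combination -hs + hD
    · field_simp
      ring

theorem mem_hyperbolaProjection_of_im_ne_zero {δ t : ℂ} (hδ : δ.im ≠ 0) :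
    t ∈ hyperbolaProjection δ ↔
      4 * (t.re * t.im) ^ 2 + 4 * δ.re * (t.re * t.im) - δ.im ^ 2 ≤ 0 ∧ t ≠ 0 := by
  have hpos : 0 < δ.im ^ 2 := by positivity
  by_cases hu : t.re = 0
  · by_cases hv : t.im = 0
    · have ht : t = 0 := Complex.ext hu hv
      refine ⟨?_, fun h => absurd ht h.2⟩
      rintro ⟨x₁, x₂, -, h⟩
      rw [hu, hv] at h
      exact absurd (by linarith) hδ
    · refine ⟨fun _ => ⟨by rw [hu]; nlinarith, fun h => hv (by rw [h]; rfl)⟩, fun _ => ?_⟩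
      exact ⟨δ.im / t.im, δ.re * t.im / δ.im, by rw [hu]; field_simp; simp,
        by rw [hu]; field_simp; simp⟩
  · by_cases hv : t.im = 0
    · refine ⟨fun _ => ⟨by rw [hv]; nlinarith, fun h => hu (by rw [h]; rfl)⟩, fun _ => ?_⟩
      exact ⟨δ.re * t.re / δ.im, δ.im / t.re, by rw [hv]; field_simp; simp,
        by rw [hv]; field_simp; simp⟩
    · rw [mem_hyperbolaProjection_of_ne_zero hu hv]
      exact ⟨fun h => ⟨h, fun h0 => hu (by rw [h0]; rfl)⟩, fun h => h.1⟩

theorem mem_hyperbolaProjection_of_im_eq_zero {δ t : ℂ} (hδ : δ.im = 0) (hδ' : δ.re ≠ 0) :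
    t ∈ hyperbolaProjection δ ↔
      t.re * t.im * (t.re * t.im + δ.re) ≤ 0 ∧ (t.re * t.im ≠ 0 ∨ t = 0) := by
  by_cases hu : t.re = 0
  · by_cases hv : t.im = 0
    · have ht : t = 0 := Complex.ext hu hv
      refine ⟨fun _ => ⟨by rw [hu]; simp, Or.inr ht⟩, fun _ => ?_⟩
      exact ⟨1, δ.re, by rw [hu]; ring, by rw [hu, hv, hδ]; ring⟩
    · refine ⟨?_, ?_⟩
      · rintro ⟨x₁, x₂, h1, h2⟩
        rw [hu, hδ] at h2
        rw [hu] at h1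
        have : x₁ = 0 := by simpa [hv] using h2
        rw [this] at h1
        exact absurd (by linarith) hδ'
      · rintro ⟨-, h | h⟩
        · exact absurd (by rw [hu, zero_mul]) h
        · exact absurd (by rw [h]; rfl) hv
  · by_cases hv : t.im = 0
    · refine ⟨?_, ?_⟩
      · rintro ⟨x₁, x₂, h1, h2⟩
        rw [hv, hδ] at h2
        rw [hv] at h1
        have : x₂ = 0 := by simpa [hu] using h2
        rw [this] at h1
        exact absurd (by linarith) hδ'
      · rintro ⟨-, h | h⟩
        · exact absurd (by rw [hv, mul_zero]) h
        · exact absurd (by rw [h]; rfl) hu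
    · rw [mem_hyperbolaProjection_of_ne_zero hu hv, hδ]
      refine ⟨fun h => ⟨by nlinarith, Or.inl (mul_ne_zero hu hv)⟩, fun h => by nlinarith [h.1]⟩

theorem mem_hyperbolaProjection_zero {t : ℂ} :
    t ∈ hyperbolaProjection 0 ↔ t.re * t.im = 0 := by
  constructor
  · intro h
    by_contra hne
    have := (mem_hyperbolaProjection_of_ne_zero (left_ne_zero_of_mul hne)
      (right_ne_zero_of_mul hne)).1 h
    have hpos : 0 < (t.re * t.im) ^ 2 := by positivity
    simp only [Complex.zero_re, Complex.zero_im] at this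
    linarith
  · intro h
    exact ⟨0, 0, by simp [h], by simp⟩

/-- The boundary is `g = 0` together with the origin, a puncture of the projection. As a quadratic
in `Re t · Im t`, `g` has real roots and splits into two hyperbolas. -/
theorem isConicalSet_frontier_hyperbolaProjection_of_im_ne_zero {δ : ℂ} (hδ : δ.im ≠ 0) :
    IsConicalSet (frontier (hyperbolaProjection δ)) := by
  let g : ℂ → ℝ := fun t => 4 * (t.re * t.im) ^ 2 + 4 * δ.re * (t.re * t.im) - δ.im ^ 2
  have hg : Continuous g := by fun_prop
  have hpos : 0 < δ.im ^ 2 := by positivity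
  have hmem : ∀ t, t ∈ hyperbolaProjection δ ↔ g t ≤ 0 ∧ t ≠ 0 :=
    fun t => mem_hyperbolaProjection_of_im_ne_zero hδ
  have hfront : frontier (hyperbolaProjection δ) = {t | g t = 0 ∨ t = 0} := by
    apply Set.Subset.antisymm
    · rintro t ⟨hcl, hint⟩
      have hle : g t ≤ 0 := closure_minimal (fun x hx => ((hmem x).1 hx).1)
        (isClosed_le hg continuous_const) hcl
      by_contra! hne
      rw [Set.mem_ofPred_eq, not_or] at hne
      apply hint
      refine interior_maximal (fun x hx => (hmem x).2 ⟨hx.1.le, hx.2⟩)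
        ((isOpen_lt hg continuous_const).inter isOpen_ne) ⟨lt_of_le_of_ne hle hne.1, hne.2⟩
    · intro t ht
      rw [frontier_eq_closure_inter_closure]
      rcases ht with ht | rfl
      · constructor
        · refine subset_closure ((hmem t).2 ⟨ht.le, ?_⟩)
          rintro rfl
          simp [g] at ht
          exact hδ ht
        · have := mem_closure_of_path (S := (hyperbolaProjection δ)ᶜ)
            (fun ε => ((1 + ε : ℝ) : ℂ) * t) (by fun_prop) one_pos fun ε h0 h1 => ?_
          · simpa using this
          · intro hin
            have h2 := ((hmem _).1 hin).1
            simp only [g, Complex.re_ofReal_mul, Complex.im_ofReal_mul] at h2 ht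
            have h3 : 0 < ((1 + ε) ^ 2 - 1) * (4 * (1 + ε) ^ 2 * (t.re * t.im) ^ 2 + δ.im ^ 2) :=
              mul_pos (by nlinarith) (by positivity)
            refine absurd h2 (not_le.2 (h3.trans_eq ?_))
            linear_combination -(1 + ε) ^ 2 * ht
      · constructor
        · have := mem_closure_of_path (S := hyperbolaProjection δ) (fun ε => (ε : ℂ))
            (by fun_prop) one_pos fun ε h0 h1 => ?_
          · simpa using this
          · rw [hmem]
            exact ⟨by simp [g]; positivity, by exact_mod_cast h0.ne'⟩
        · exact subset_closure fun h => ((hmem 0).1 h).2 rfl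
  rw [hfront]
  intro T hre him
  have hgT : IsPolyFun 4 fun y => g (T y) := by
    have h4 := ((hre.mul him).pow 2).const_mul 4
    have h2 := (hre.mul him).const_mul (4 * δ.re)
    exact (h4.add (h2.mono (by norm_num))).sub (.const _)
  constructor
  -- The union of `g = 0` with the origin is cut out by `g · Re` and `g · Im`.
  · convert (hgT.mul hre).isAlgebraicSet_and (hgT.mul him) using 1
    ext y
    simp only [Set.mem_preimage, Set.mem_ofPred_eq, mul_eq_zero]
    rw [← or_and_left, Complex.ext_iff]
    rfl
  · refine ((liesOnCurve_preimage_hyperbola T hre him ((δ.re - ‖δ‖) / 2)).union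
      ((liesOnCurve_preimage_hyperbola T hre him ((δ.re + ‖δ‖) / 2)).union
        (liesOnCurve_preimage_re T hre))).mono ?_ le_rfl
    rintro y (hy | hy)
    · have hn : ‖δ‖ ^ 2 = δ.re ^ 2 + δ.im ^ 2 := by
        rw [← Complex.normSq_eq_norm_sq, Complex.normSq_apply]
        ring
      have hprod : ((T y).re * (T y).im + (δ.re - ‖δ‖) / 2) *
          ((T y).re * (T y).im + (δ.re + ‖δ‖) / 2) = 0 := by
        have hy' : g (T y) = 0 := hy
        simp only [g] at hy'
        linear_combination hy' / 4 - hn / 4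
      rcases mul_eq_zero.1 hprod with h | h
      · exact Or.inl h
      · exact Or.inr (Or.inl h)
    · refine Or.inr (Or.inr ?_)
      have hy' : T y = 0 := hy
      change (T y).re = 0
      rw [hy']
      rfl

theorem add_sign_ne {x ε : ℝ} (hε : 0 < ε) : |x| < |x + ε * (if 0 ≤ x then 1 else -1)| := by
  split_ifs with h
  · rw [abs_of_nonneg h, abs_of_nonneg] <;> linarith
  · rw [abs_of_neg (not_le.1 h), abs_of_neg] <;> linarith

theorem isConicalSet_frontier_hyperbolaProjection_zero :
    IsConicalSet (frontier (hyperbolaProjection 0)) := by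
  have hset : hyperbolaProjection 0 = {t | t.re * t.im = 0} :=
    Set.ext fun t => mem_hyperbolaProjection_zero
  have hclosed : IsClosed {t : ℂ | t.re * t.im = 0} :=
    isClosed_eq (by fun_prop) continuous_const
  have hfront : frontier (hyperbolaProjection 0) = {t | t.re * t.im + 0 = 0} := by
    rw [hset, frontier_eq_closure_inter_closure, hclosed.closure_eq]
    simp only [add_zero]
    refine Set.inter_eq_left.2 fun t _ => ?_
    let c : ℝ → ℂ := fun ε => ((t.re + ε * (if 0 ≤ t.re then 1 else -1) : ℝ) : ℂ) +
      ((t.im + ε * (if 0 ≤ t.im then 1 else -1) : ℝ) : ℂ) * Complex.I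
    have := mem_closure_of_path (S := {t : ℂ | t.re * t.im = 0}ᶜ) c (by fun_prop) one_pos
      fun ε h0 h1 => ?_
    · simpa [c] using this
    · have h2 := (abs_nonneg _).trans_lt (add_sign_ne (x := t.re) h0)
      have h3 := (abs_nonneg _).trans_lt (add_sign_ne (x := t.im) h0)
      have h4 := mul_ne_zero (abs_pos.1 h2) (abs_pos.1 h3)
      have hcre : (c ε).re = t.re + ε * (if 0 ≤ t.re then 1 else -1) := by simp [c]
      have hcim : (c ε).im = t.im + ε * (if 0 ≤ t.im then 1 else -1) := by simp [c]
      rwa [← hcre, ← hcim] at h4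
  rw [hfront]
  exact fun T hre him => ⟨((hre.mul him).add (.const 0)).isAlgebraicSet,
    liesOnCurve_preimage_hyperbola T hre him 0⟩

theorem isConicalSet_frontier_hyperbolaProjection_of_im_eq_zero {δ : ℂ} (hδ : δ.im = 0)
    (hδ' : δ.re ≠ 0) : IsConicalSet (frontier (hyperbolaProjection δ)) := by
  set d := δ.re with hd
  let g : ℂ → ℝ := fun t => t.re * t.im * (t.re * t.im + d)
  have hg : Continuous g := by fun_prop
  have hpos : 0 < d ^ 2 := by positivity
  have hmem : ∀ t, t ∈ hyperbolaProjection δ ↔ g t ≤ 0 ∧ (t.re * t.im ≠ 0 ∨ t = 0) :=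
    fun t => mem_hyperbolaProjection_of_im_eq_zero hδ hδ'
  have hfront : frontier (hyperbolaProjection δ) = {t | g t = 0} := by
    apply Set.Subset.antisymm
    · rintro t ⟨hcl, hint⟩
      have hle : g t ≤ 0 := closure_minimal (fun x hx => ((hmem x).1 hx).1)
        (isClosed_le hg continuous_const) hcl
      by_contra hne
      apply hint
      exact interior_maximal
        (fun x hx => (hmem x).2 ⟨le_of_lt hx, Or.inl (left_ne_zero_of_mul (ne_of_lt hx))⟩)
        (isOpen_lt hg continuous_const) (lt_of_le_of_ne hle hne)
    · intro t ht
      rw [frontier_eq_closure_inter_closure]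
      rcases mul_eq_zero.1 ht with h | h
      · constructor
        -- Points with `Re t · Im t = -dε` lie in the projection and approach the axes.
        · have hlt : ∀ ε : ℝ, 0 < ε → ε < 1 → -d * ε ≠ 0 ∧ -d * ε * (-d * ε + d) ≤ 0 :=
            fun ε h0 h1 => ⟨mul_ne_zero (neg_ne_zero.2 hδ') h0.ne', by
              have : 0 ≤ d ^ 2 * (ε * (1 - ε)) :=
                mul_nonneg hpos.le (mul_nonneg h0.le (by linarith))
              linarith⟩
          by_cases hu : t.re = 0
          · by_cases hv : t.im = 0
            · refine subset_closure ((hmem t).2 ⟨ht.le, Or.inr (Complex.ext hu hv)⟩)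
            · have := mem_closure_of_path (S := hyperbolaProjection δ)
                (fun ε => ((-d * ε / t.im : ℝ) : ℂ) + (t.im : ℂ) * Complex.I) (by fun_prop)
                one_pos fun ε h0 h1 => ?_
              · convert this using 1
                apply Complex.ext <;> simp [hu]
              · have hm : (-d * ε / t.im) * t.im = -d * ε := div_mul_cancel₀ _ hv
                rw [hmem]
                simp only [g, Complex.add_re, Complex.add_im, Complex.ofReal_re, Complex.ofReal_im,
                  Complex.mul_I_re, Complex.mul_I_im, zero_add, neg_zero, add_zero, hm]
                exact ⟨(hlt ε h0 h1).2, Or.inl (hlt ε h0 h1).1⟩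
          · have hv : t.im = 0 := (mul_eq_zero.1 h).resolve_left hu
            have := mem_closure_of_path (S := hyperbolaProjection δ)
              (fun ε => (t.re : ℂ) + ((-d * ε / t.re : ℝ) : ℂ) * Complex.I) (by fun_prop)
              one_pos fun ε h0 h1 => ?_
            · convert this using 1
              apply Complex.ext <;> simp [hv]
            · have hm : t.re * (-d * ε / t.re) = -d * ε := mul_div_cancel₀ _ hu
              rw [hmem]
              simp only [g, Complex.add_re, Complex.add_im, Complex.ofReal_re, Complex.ofReal_im,
                Complex.mul_I_re, Complex.mul_I_im, zero_add, neg_zero, add_zero, hm]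
              exact ⟨(hlt ε h0 h1).2, Or.inl (hlt ε h0 h1).1⟩
        · by_cases ht0 : t = 0
          · have := mem_closure_of_path (S := (hyperbolaProjection δ)ᶜ) (fun ε => (ε : ℂ))
              (by fun_prop) one_pos fun ε h0 h1 => ?_
            · simpa [ht0] using this
            · intro hin
              rcases ((hmem _).1 hin).2 with h' | h'
              · simp at h'
              · exact h0.ne' (by exact_mod_cast h')
          · refine subset_closure fun hin => ?_
            rcases ((hmem _).1 hin).2 with h' | h'
            · exact h' h
            · exact ht0 h'
      · have huv : t.re * t.im = -d := by linarith
        constructor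
        · exact subset_closure ((hmem t).2 ⟨ht.le, Or.inl (by rw [huv]; exact neg_ne_zero.2 hδ')⟩)
        · have := mem_closure_of_path (S := (hyperbolaProjection δ)ᶜ)
            (fun ε => ((1 + ε : ℝ) : ℂ) * t) (by fun_prop) one_pos fun ε h0 h1 => ?_
          · simpa using this
          · intro hin
            have h2 := ((hmem _).1 hin).1
            simp only [g, Complex.re_ofReal_mul, Complex.im_ofReal_mul] at h2
            have h3 : (1 + ε) * t.re * ((1 + ε) * t.im) = -((1 + ε) ^ 2 * d) := by
              linear_combination (1 + ε) ^ 2 * huv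
            rw [h3] at h2
            have h4 : 0 < d ^ 2 * ((1 + ε) ^ 2 * ((1 + ε) ^ 2 - 1)) :=
              mul_pos hpos (mul_pos (by positivity) (by nlinarith))
            linarith
  rw [hfront]
  intro T hre him
  refine ⟨((hre.mul him).mul ((hre.mul him).add (.const d))).isAlgebraicSet, ?_⟩
  refine ((liesOnCurve_preimage_hyperbola T hre him 0).union
    (liesOnCurve_preimage_hyperbola T hre him d)).mono (fun y hy => ?_) le_rfl
  rcases mul_eq_zero.1 (show (T y).re * (T y).im * ((T y).re * (T y).im + d) = 0 from hy) with h | h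
  · exact Or.inl (by simpa using h)
  · exact Or.inr h

theorem isConicalSet_frontier_hyperbolaProjection (δ : ℂ) :
    IsConicalSet (frontier (hyperbolaProjection δ)) := by
  by_cases him : δ.im = 0
  · by_cases hre : δ.re = 0
    · rw [show δ = 0 from Complex.ext hre him]
      exact isConicalSet_frontier_hyperbolaProjection_zero
    · exact isConicalSet_frontier_hyperbolaProjection_of_im_eq_zero him hre
  · exact isConicalSet_frontier_hyperbolaProjection_of_im_ne_zero him

/-! ### Double real lines -/

theorem isConicalSet_frontier_parallel_lines (k : ℝ) :
    IsConicalSet (frontier {t : ℂ | t.re ^ 2 = k ^ 2}) := by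
  have hclosed : IsClosed {t : ℂ | t.re ^ 2 = k ^ 2} := isClosed_eq (by fun_prop) continuous_const
  have hfront : frontier {t : ℂ | t.re ^ 2 = k ^ 2} = {t : ℂ | t.re ^ 2 - k ^ 2 = 0} := by
    rw [frontier_eq_closure_inter_closure, hclosed.closure_eq]
    simp only [sub_eq_zero]
    refine Set.inter_eq_left.2 fun t ht => ?_
    let c : ℝ → ℂ := fun ε => ((t.re + ε * (if 0 ≤ t.re then 1 else -1) : ℝ) : ℂ) +
      (t.im : ℂ) * Complex.I
    have := mem_closure_of_path (S := {t : ℂ | t.re ^ 2 = k ^ 2}ᶜ) c (by fun_prop) one_pos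
      fun ε h0 h1 => ?_
    · simpa [c] using this
    · have h2 := sq_lt_sq.2 (add_sign_ne (x := t.re) h0)
      have hcre : (c ε).re = t.re + ε * (if 0 ≤ t.re then 1 else -1) := by simp [c]
      rw [← hcre] at h2
      have ht' : t.re ^ 2 = k ^ 2 := ht
      rw [ht'] at h2
      exact h2.ne'
  rw [hfront]
  intro T hre him
  have hf : IsPolyFun 2 fun y => (T y).re ^ 2 - k ^ 2 := (hre.pow 2).sub (.const _)
  refine ⟨hf.isAlgebraicSet, hf.liesOnCurve (y₀ := T.symm ((|k| + 1 : ℝ) : ℂ)) ?_ fun y hy => hy⟩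
  simp only [Homeomorph.apply_symm_apply, Complex.ofReal_re]
  nlinarith [abs_nonneg k, sq_abs k]

/-- The imaginary projection of the parabola `z₂ = δ z₁²`, in the coordinate
`Im z₁ + i Im z₂`. -/
def parabolaProjection (δ : ℂ) : Set ℂ :=
  {t | ∃ x : ℝ, t.im = δ.im * (x ^ 2 - t.re ^ 2) + 2 * δ.re * x * t.re}

/-- For real `δ` only the line `Re t = 0` without the origin is missed. Otherwise completing the
square in `x` gives `δ.im · Im t + |δ|² (Re t)² = (δ.im x + δ.re Re t)²`, so the boundary is a
parabola. -/
theorem isConicalSet_frontier_parabolaProjection {δ : ℂ} (hδ : δ ≠ 0) :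
    IsConicalSet (frontier (parabolaProjection δ)) := by
  by_cases him : δ.im = 0
  · have hre : δ.re ≠ 0 := fun h => hδ (Complex.ext h him)
    have hmem : ∀ t, t ∈ parabolaProjection δ ↔ t.re ≠ 0 ∨ t = 0 := by
      intro t
      constructor
      · rintro ⟨x, hx⟩
        by_contra! hne
        exact hne.2 (Complex.ext hne.1 (by rw [hx, him, hne.1]; simp))
      · rintro (h | rfl)
        · exact ⟨t.im / (2 * δ.re * t.re), by rw [him]; field_simp; ring⟩
        · exact ⟨0, by simp⟩
    have hfront : frontier (parabolaProjection δ) = {t | t.re = 0} := by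
      apply Set.Subset.antisymm
      · rintro t ⟨-, hint⟩
        by_contra hne
        exact hint (interior_maximal (fun x hx => (hmem x).2 (Or.inl hx))
          (isOpen_ne_fun Complex.continuous_re continuous_const) hne)
      · intro t ht
        have ht' : t.re = 0 := ht
        rw [frontier_eq_closure_inter_closure]
        constructor
        · have := mem_closure_of_path (S := parabolaProjection δ)
            (fun ε => (ε : ℂ) + (t.im : ℂ) * Complex.I) (by fun_prop) one_pos fun ε h0 h1 => ?_
          · convert this using 1
            apply Complex.ext <;> simp [ht']
          · rw [hmem]
            left
            simpa using h0.ne'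
        · by_cases ht0 : t = 0
          · have := mem_closure_of_path (S := (parabolaProjection δ)ᶜ)
              (fun ε => (ε : ℂ) * Complex.I) (by fun_prop) one_pos fun ε h0 h1 => ?_
            · simpa [ht0] using this
            · intro hin
              rcases (hmem _).1 hin with h' | h'
              · simp at h'
              · simp [h0.ne'] at h'
          · refine subset_closure fun hin => ?_
            rcases (hmem _).1 hin with h' | h'
            · exact h' ht
            · exact ht0 h'
    rw [hfront]
    exact fun T hTre _ => ⟨hTre.isAlgebraicSet, liesOnCurve_preimage_re T hTre⟩
  · let g : ℂ → ℝ := fun t => δ.im * t.im + (δ.re ^ 2 + δ.im ^ 2) * t.re ^ 2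
    have hg : Continuous g := by fun_prop
    have hmem : ∀ t, t ∈ parabolaProjection δ ↔ 0 ≤ g t := by
      intro t
      constructor
      · rintro ⟨x, hx⟩
        simp only [g]
        rw [hx]
        nlinarith [sq_nonneg (δ.im * x + δ.re * t.re)]
      · intro h
        have hs := Real.sq_sqrt h
        refine ⟨(Real.sqrt (g t) - δ.re * t.re) / δ.im, ?_⟩
        have hgt : g t = δ.im * t.im + (δ.re ^ 2 + δ.im ^ 2) * t.re ^ 2 := rfl
        field_simp
        linear_combination -hs - hgt
    have hfront : frontier (parabolaProjection δ) = {t | g t = 0} := by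
      apply Set.Subset.antisymm
      · rintro t ⟨hcl, hint⟩
        have hle : 0 ≤ g t := closure_minimal (fun x hx => (hmem x).1 hx)
          (isClosed_le continuous_const hg) hcl
        by_contra hne
        exact hint (interior_maximal (fun x hx => (hmem x).2 (le_of_lt hx))
          (isOpen_lt continuous_const hg) (lt_of_le_of_ne hle (Ne.symm hne)))
      · intro t ht
        rw [frontier_eq_closure_inter_closure]
        constructor
        · exact subset_closure ((hmem t).2 (ge_of_eq ht))
        · have := mem_closure_of_path (S := (parabolaProjection δ)ᶜ)
            (fun ε => (t.re : ℂ) + ((t.im - ε * δ.im : ℝ) : ℂ) * Complex.I) (by fun_prop)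
            one_pos fun ε h0 h1 => ?_
          · simpa using this
          · intro hin
            have h2 := (hmem _).1 hin
            have ht' : δ.im * t.im + (δ.re ^ 2 + δ.im ^ 2) * t.re ^ 2 = 0 := ht
            simp only [g, Complex.add_re, Complex.add_im, Complex.ofReal_re, Complex.ofReal_im,
              Complex.mul_I_re, Complex.mul_I_im, zero_add, neg_zero, add_zero] at h2
            have h3 : 0 < ε * δ.im ^ 2 := by positivity
            linarith
    rw [hfront]
    intro T hTre hTim
    have hf : IsPolyFun 2 fun y => g (T y) :=
      ((hTim.const_mul δ.im).mono one_le_two).add ((hTre.pow 2).const_mul _)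
    refine ⟨hf.isAlgebraicSet, hf.liesOnCurve (y₀ := T.symm Complex.I) ?_ fun y hy => hy⟩
    simpa [g] using him

/-! ### Coefficients, factorization and affine coordinates -/

theorem exists_eval_eq_of_totalDegree_eq_two {p : MvPolynomial (Fin 2) ℂ}
    (hp : p.totalDegree = 2) : ∃ q₀ q₁ q₂ l₀ l₁ c : ℂ,
      (∀ z : Fin 2 → ℂ, eval z p =
        q₀ * z 0 ^ 2 + q₁ * (z 0 * z 1) + q₂ * z 1 ^ 2 + l₀ * z 0 + l₁ * z 1 + c) ∧
      (q₀ ≠ 0 ∨ q₁ ≠ 0 ∨ q₂ ≠ 0) ∧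
      (HasRealCoeffs p → conj q₀ = q₀ ∧ conj q₁ = q₁ ∧ conj q₂ = q₂) := by
  let m : ℕ → ℕ → (Fin 2 →₀ ℕ) := fun i j => Finsupp.single 0 i + Finsupp.single 1 j
  have hm0 : ∀ i j, m i j 0 = i := fun i j => by simp [m]
  have hm1 : ∀ i j, m i j 1 = j := fun i j => by simp [m]
  have hm : ∀ d : Fin 2 →₀ ℕ, d = m (d 0) (d 1) := fun d => by
    ext i
    fin_cases i
    · exact (hm0 _ _).symm
    · exact (hm1 _ _).symm
  have hdeg : ∀ d ∈ p.support, d 0 + d 1 ≤ 2 := fun d hd => by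
    have := le_totalDegree hd
    rwa [hp, Finsupp.sum_fintype _ _ (fun _ => rfl), Fin.sum_univ_two] at this
  have hzero : ∀ i j, 2 < i + j → p.coeff (m i j) = 0 := fun i j hij => by
    by_contra hne
    have := hdeg _ (mem_support_iff.2 hne)
    rw [hm0, hm1] at this
    omega
  refine ⟨p.coeff (m 2 0), p.coeff (m 1 1), p.coeff (m 0 2), p.coeff (m 1 0), p.coeff (m 0 1),
    p.coeff (m 0 0), fun z => ?_, ?_, fun hreal => ?_⟩
  · let s : Finset (ℕ × ℕ) := Finset.range 3 ×ˢ Finset.range 3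
    have hinj : Set.InjOn (fun x : ℕ × ℕ => m x.1 x.2) s := by
      rintro ⟨i, j⟩ - ⟨i', j'⟩ - h
      have h' : m i j = m i' j' := h
      have e0 := congrArg (fun d : Fin 2 →₀ ℕ => d 0) h'
      have e1 := congrArg (fun d : Fin 2 →₀ ℕ => d 1) h'
      simp only [hm0, hm1] at e0 e1
      rw [e0, e1]
    have hsub : p.support ⊆ s.image fun x : ℕ × ℕ => m x.1 x.2 := by
      intro d hd
      have := hdeg d hd
      refine Finset.mem_image.2 ⟨(d 0, d 1), ?_, (hm d).symm⟩
      simp only [s, Finset.mem_product, Finset.mem_range]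
      omega
    rw [eval_eq', Finset.sum_subset hsub fun d _ hd => by rw [notMem_support_iff.1 hd, zero_mul],
      Finset.sum_image hinj, Finset.sum_product]
    simp only [Finset.sum_range_succ, Finset.sum_range_zero, Fin.prod_univ_two, hm0, hm1,
      hzero 2 1 (by norm_num), hzero 1 2 (by norm_num), hzero 2 2 (by norm_num)]
    ring
  · by_contra! hcon
    have : p.totalDegree ≤ 1 := by
      refine Finset.sup_le fun d hd => ?_
      rw [Finsupp.sum_fintype _ _ (fun _ => rfl), Fin.sum_univ_two]
      by_contra hlt
      have h2 := hdeg d hd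
      have hne := mem_support_iff.1 hd
      rw [hm d] at hne
      have hcases : (d 0 = 2 ∧ d 1 = 0) ∨ (d 0 = 1 ∧ d 1 = 1) ∨ (d 0 = 0 ∧ d 1 = 2) := by omega
      rcases hcases with ⟨h0, h1⟩ | ⟨h0, h1⟩ | ⟨h0, h1⟩ <;> rw [h0, h1] at hne
      · exact hne hcon.1
      · exact hne hcon.2.1
      · exact hne hcon.2.2
    omega
  · exact ⟨Complex.conj_eq_iff_im.2 (hreal _), Complex.conj_eq_iff_im.2 (hreal _),
      Complex.conj_eq_iff_im.2 (hreal _)⟩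

theorem exists_binary_quadratic_eq_mul (q₀ q₁ q₂ : ℂ) (h : q₀ ≠ 0 ∨ q₁ ≠ 0 ∨ q₂ ≠ 0) :
    ∃ α₀ α₁ β₀ β₁ : ℂ, q₀ = α₀ * β₀ ∧ q₁ = α₀ * β₁ + α₁ * β₀ ∧ q₂ = α₁ * β₁ ∧
      (α₀ ≠ 0 ∨ α₁ ≠ 0) ∧ (β₀ ≠ 0 ∨ β₁ ≠ 0) := by
  by_cases h0 : q₀ = 0
  · refine ⟨0, 1, q₁, q₂, by simp [h0], by ring, by ring, by simp, ?_⟩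
    simpa [h0] using h
  · obtain ⟨s, hs⟩ := IsAlgClosed.exists_pow_nat_eq (q₁ ^ 2 - 4 * q₀ * q₂) (n := 2) (by norm_num)
    refine ⟨q₀, (q₁ - s) / 2, 1, (q₁ + s) / (2 * q₀), by ring, by field_simp; ring, ?_,
      Or.inl h0, Or.inl one_ne_zero⟩
    field_simp
    linear_combination hs

theorem exists_linear_system_solution {K : Type*} [Field K] {a b c d : K} (h : a * d - b * c ≠ 0)
    (e f : K) : ∃ x y : K, a * x + b * y = e ∧ c * x + d * y = f :=
  ⟨(d * e - b * f) / (a * d - b * c), (a * f - c * e) / (a * d - b * c),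
    by rw [mul_div_assoc', mul_div_assoc', ← add_div, div_eq_iff h]; ring,
    by rw [mul_div_assoc', mul_div_assoc', ← add_div, div_eq_iff h]; ring⟩

theorem exists_affine_homeomorph {μ₀ μ₁ : ℂ} (h : μ₀.re * μ₁.im - μ₁.re * μ₀.im ≠ 0) (k : ℂ) :
    ∃ T : (Fin 2 → ℝ) ≃ₜ ℂ, (∀ y, T y = μ₀ * y 0 + μ₁ * y 1 + k) ∧
      IsPolyFun 1 (fun y => (T y).re) ∧ IsPolyFun 1 (fun y => (T y).im) := by
  set D := μ₀.re * μ₁.im - μ₁.re * μ₀.im with hD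
  have hi : D * D⁻¹ = 1 := mul_inv_cancel₀ h
  let T : (Fin 2 → ℝ) ≃ₜ ℂ :=
    { toFun := fun y => μ₀ * y 0 + μ₁ * y 1 + k
      invFun := fun t =>
        ![(μ₁.im * (t.re - k.re) - μ₁.re * (t.im - k.im)) * D⁻¹,
          (μ₀.re * (t.im - k.im) - μ₀.im * (t.re - k.re)) * D⁻¹]
      left_inv := fun y => by
        funext i
        fin_cases i
        · simp
          linear_combination y 0 * hi - y 0 * D⁻¹ * hD
        · simp
          linear_combination y 1 * hi - y 1 * D⁻¹ * hD
      right_inv := fun t => by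
        apply Complex.ext
        · simp only [Complex.add_re, Complex.mul_re, Complex.ofReal_re, Complex.ofReal_im,
            Matrix.cons_val_zero, Matrix.cons_val_one]
          linear_combination (t.re - k.re) * hi - (t.re - k.re) * D⁻¹ * hD
        · simp only [Complex.add_im, Complex.mul_im, Complex.ofReal_re, Complex.ofReal_im,
            Matrix.cons_val_zero, Matrix.cons_val_one]
          linear_combination (t.im - k.im) * hi - (t.im - k.im) * D⁻¹ * hD
      continuous_toFun := by fun_prop
      continuous_invFun := by
        refine continuous_pi fun i => ?_
        fin_cases i
        · simp
          fun_prop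
        · simp
          fun_prop }
  have hT : ∀ y, T y = μ₀ * y 0 + μ₁ * y 1 + k := fun _ => rfl
  refine ⟨T, hT, ?_, ?_⟩
  · have : (fun y => (T y).re) = fun y => μ₀.re * y 0 + μ₁.re * y 1 + k.re := by
      funext y
      rw [hT]
      simp
    rw [this]
    exact (((IsPolyFun.coord 0).const_mul _).add ((IsPolyFun.coord 1).const_mul _)).add (.const _)
  · have : (fun y => (T y).im) = fun y => μ₀.im * y 0 + μ₁.im * y 1 + k.im := by
      funext y
      rw [hT]
      simp
    rw [this]
    exact (((IsPolyFun.coord 0).const_mul _).add ((IsPolyFun.coord 1).const_mul _)).add (.const _)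

/-! ### Reduction of conics to normal forms -/

theorem imagBoundary_eq_frontier {n : ℕ} (p : MvPolynomial (Fin n) ℂ) :
    imagBoundary p = frontier (imagProjection p) :=
  frontier_eq_closure_inter_closure.symm

theorem imagBoundary_of_eq_preimage {n : ℕ} {p : MvPolynomial (Fin n) ℂ} {S : Set ℂ}
    (T : (Fin n → ℝ) ≃ₜ ℂ) (hI : imagProjection p = T ⁻¹' S) :
    imagBoundary p = T ⁻¹' frontier S := by
  rw [imagBoundary_eq_frontier, hI, T.preimage_frontier]

theorem imagBoundary_of_eq_univ {n : ℕ} {p : MvPolynomial (Fin n) ℂ}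
    (hI : imagProjection p = Set.univ) : imagBoundary p = ∅ := by
  rw [imagBoundary_eq_frontier, hI, frontier_univ]

/-- The conclusion that holds for all conics outside the family with degree eight boundaries. -/
def HasConicalBoundary (p : MvPolynomial (Fin 2) ℂ) : Prop :=
  IsAlgebraicSet (imagBoundary p) ∧ LiesOnCurve (imagBoundary p) 2

theorem hasConicalBoundary_of_eq_univ {p : MvPolynomial (Fin 2) ℂ}
    (hI : imagProjection p = Set.univ) : HasConicalBoundary p := by
  rw [HasConicalBoundary, imagBoundary_of_eq_univ hI]
  exact ⟨isAlgebraicSet_empty, liesOnCurve_empty 2⟩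

theorem conj_eq_sub_of_im_eq {z : ℂ} {y : ℝ} (h : z.im = y) :
    conj z = z - 2 * Complex.I * y := by
  apply Complex.ext <;> simp [← h]
  ring

/-- A form not proportional to a real one maps `ℝ²` bijectively onto `ℂ`, so the real parts can be
chosen to reach any `w`. -/
theorem exists_vector_of_linear_form {α₀ α₁ : ℂ} (h : α₀.re * α₁.im - α₁.re * α₀.im ≠ 0)
    (y : Fin 2 → ℝ) (w : ℂ) :
    ∃ z : Fin 2 → ℂ, (∀ j, (z j).im = y j) ∧ α₀ * z 0 + α₁ * z 1 = w := by
  set v := w - Complex.I * (α₀ * y 0 + α₁ * y 1) with hv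
  obtain ⟨x₀, x₁, h0, h1⟩ := exists_linear_system_solution h v.re v.im
  refine ⟨![x₀ + Complex.I * y 0, x₁ + Complex.I * y 1], ?_, ?_⟩
  · intro j
    fin_cases j <;> simp
  · have hx : α₀ * x₀ + α₁ * x₁ = v := by
      apply Complex.ext
      · simpa using h0
      · simpa using h1
    simp only [Matrix.cons_val_zero, Matrix.cons_val_one]
    linear_combination hx + hv

theorem mem_imagProjection_iff_mem_solvableShifts {p : MvPolynomial (Fin 2) ℂ}
    {α₀ α₁ a a₀ b₀ γ k : ℂ} (hα : α₀.re * α₁.im - α₁.re * α₀.im ≠ 0) (hk : k ≠ 0)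
    (hp : ∀ z : Fin 2 → ℂ, eval z p = k * ((α₀ * z 0 + α₁ * z 1 - a₀) *
      ((a * α₀ + conj α₀) * z 0 + (a * α₁ + conj α₁) * z 1 - b₀) + γ)) (y : Fin 2 → ℝ) :
    y ∈ imagProjection p ↔ 2 * Complex.I * conj α₀ * y 0 + 2 * Complex.I * conj α₁ * y 1 +
      (conj a₀ + a * a₀ - b₀) ∈ solvableShifts a γ := by
  have key : ∀ z : Fin 2 → ℂ, (∀ j, (z j).im = y j) → ∀ ω, ω = α₀ * z 0 + α₁ * z 1 - a₀ →
      eval z p = k * (ω * conj ω + a * ω ^ 2 + (2 * Complex.I * conj α₀ * y 0 +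
        2 * Complex.I * conj α₁ * y 1 + (conj a₀ + a * a₀ - b₀)) * ω + γ) := by
    rintro z hz ω rfl
    rw [hp]
    simp only [map_sub, map_add, map_mul, conj_eq_sub_of_im_eq (hz 0), conj_eq_sub_of_im_eq (hz 1)]
    ring
  constructor
  · rintro ⟨z, hz0, hz⟩
    rw [key z hz _ rfl] at hz0
    exact ⟨_, (mul_eq_zero.1 hz0).resolve_left hk⟩
  · rintro ⟨ω, hω⟩
    obtain ⟨z, hz, hzw⟩ := exists_vector_of_linear_form hα y (ω + a₀)
    refine ⟨z, ?_, hz⟩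
    rw [key z hz ω (by rw [hzw]; ring), hω, mul_zero]

/-- Expand the linear part in the basis `α`, `ᾱ`. Completing the square absorbs the `α` part, and
the rest becomes an equation `ω² + m ω̄ = const`, which is always solvable. -/
theorem imagProjection_eq_univ_of_double_nonreal {p : MvPolynomial (Fin 2) ℂ}
    {α₀ α₁ κ l₀ l₁ c : ℂ} (hα : α₀.re * α₁.im - α₁.re * α₀.im ≠ 0) (hκ : κ ≠ 0)
    (hp : ∀ z : Fin 2 → ℂ, eval z p = κ * (α₀ * z 0 + α₁ * z 1) ^ 2 + l₀ * z 0 + l₁ * z 1 + c) :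
    imagProjection p = Set.univ := by
  refine Set.eq_univ_of_forall fun y => ?_
  have hdet : α₀ * conj α₁ - conj α₀ * α₁ ≠ 0 := fun h => hα (by
    have := congrArg Complex.im h
    simp at this
    linarith)
  obtain ⟨u, v, hu, hv⟩ := exists_linear_system_solution hdet l₀ l₁
  obtain ⟨ω, hω⟩ := exists_sq_add_mul_conj_eq (v / κ)
    (-(2 * Complex.I * (v / κ) * (conj α₀ * y 0 + conj α₁ * y 1) - (v / κ) * conj (u / (2 * κ)) +
      c / κ - (u / (2 * κ)) ^ 2))
  obtain ⟨z, hz, hzw⟩ := exists_vector_of_linear_form hα y (ω - u / (2 * κ))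
  refine ⟨z, ?_, hz⟩
  have hω' : ω = α₀ * z 0 + α₁ * z 1 + u / (2 * κ) := by rw [hzw]; ring
  have hcω : conj ω = conj α₀ * (z 0 - 2 * Complex.I * y 0) +
      conj α₁ * (z 1 - 2 * Complex.I * y 1) + conj (u / (2 * κ)) := by
    rw [hω', ← conj_eq_sub_of_im_eq (hz 0), ← conj_eq_sub_of_im_eq (hz 1)]
    simp only [map_add, map_mul]
  rw [hcω, hω'] at hω
  set e := conj (u / (2 * κ))
  rw [hp]
  field_simp at hω
  apply mul_left_cancel₀ (mul_ne_zero (show (4 : ℂ) ≠ 0 by norm_num) hκ)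
  linear_combination hω - 4 * κ * z 0 * hu - 4 * κ * z 1 * hv

theorem exists_vector_of_real_forms {r₀ r₁ s₀ s₁ : ℝ} (h : r₀ * s₁ - r₁ * s₀ ≠ 0)
    (y : Fin 2 → ℝ) (x₁ x₂ : ℝ) : ∃ z : Fin 2 → ℂ, (∀ j, (z j).im = y j) ∧
      r₀ * z 0 + r₁ * z 1 = x₁ + Complex.I * ((r₀ * y 0 + r₁ * y 1 : ℝ) : ℂ) ∧
      s₀ * z 0 + s₁ * z 1 = x₂ + Complex.I * ((s₀ * y 0 + s₁ * y 1 : ℝ) : ℂ) := by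
  obtain ⟨a, b, h0, h1⟩ := exists_linear_system_solution h x₁ x₂
  refine ⟨![a + Complex.I * y 0, b + Complex.I * y 1], ?_, ?_, ?_⟩
  · intro j
    fin_cases j <;> simp
  · rw [← h0]
    simp
    ring
  · rw [← h1]
    simp
    ring

theorem real_form_affine_coordinates {r₀ r₁ s₀ s₁ : ℝ} (h : r₀ * s₁ - r₁ * s₀ ≠ 0) (k₀ k₁ : ℝ) :
    ∃ T : (Fin 2 → ℝ) ≃ₜ ℂ, (∀ y, (T y).re = r₀ * y 0 + r₁ * y 1 - k₀) ∧
      (∀ y, (T y).im = s₀ * y 0 + s₁ * y 1 - k₁) ∧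
      IsPolyFun 1 (fun y => (T y).re) ∧ IsPolyFun 1 (fun y => (T y).im) := by
  obtain ⟨T, hT, hre, him⟩ := exists_affine_homeomorph (μ₀ := ⟨r₀, s₀⟩) (μ₁ := ⟨r₁, s₁⟩) h
    ⟨-k₀, -k₁⟩
  refine ⟨T, fun y => ?_, fun y => ?_, hre, him⟩ <;> rw [hT] <;> simp <;> ring

theorem hasConicalBoundary_of_hyperbola {p : MvPolynomial (Fin 2) ℂ} {r₀ r₁ s₀ s₁ : ℝ}
    {κ a₀ b₀ δ : ℂ} (h : r₀ * s₁ - r₁ * s₀ ≠ 0) (hκ : κ ≠ 0)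
    (hp : ∀ z : Fin 2 → ℂ, eval z p =
      κ * ((r₀ * z 0 + r₁ * z 1 - a₀) * (s₀ * z 0 + s₁ * z 1 - b₀) - δ)) :
    HasConicalBoundary p := by
  obtain ⟨T, hTre, hTim, hre, him⟩ := real_form_affine_coordinates h a₀.im b₀.im
  have hI : imagProjection p = T ⁻¹' hyperbolaProjection δ := by
    ext y
    constructor
    · rintro ⟨z, hz0, hz⟩
      rw [hp] at hz0
      have h1 := sub_eq_zero.1 ((mul_eq_zero.1 hz0).resolve_left hκ)
      refine ⟨(r₀ * z 0 + r₁ * z 1 - a₀).re, (s₀ * z 0 + s₁ * z 1 - b₀).re, ?_, ?_⟩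
      · rw [← h1, hTre, hTim]
        simp [hz]
      · rw [← h1, hTre, hTim]
        simp [hz]
        ring
    · rintro ⟨x₁, x₂, h1, h2⟩
      obtain ⟨z, hz, hr, hs⟩ := exists_vector_of_real_forms h y (x₁ + a₀.re) (x₂ + b₀.re)
      refine ⟨z, ?_, hz⟩
      rw [hp, hr, hs]
      rw [hTre, hTim] at h1 h2
      have : δ = (((x₁ + a₀.re : ℝ) : ℂ) + Complex.I * ((r₀ * y 0 + r₁ * y 1 : ℝ) : ℂ) - a₀) *
          (((x₂ + b₀.re : ℝ) : ℂ) + Complex.I * ((s₀ * y 0 + s₁ * y 1 : ℝ) : ℂ) - b₀) := by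
        apply Complex.ext
        · rw [← h1]; simp
        · rw [← h2]; simp; ring
      rw [← this, sub_self, mul_zero]
  rw [HasConicalBoundary, imagBoundary_of_eq_preimage T hI]
  exact isConicalSet_frontier_hyperbolaProjection δ T hre him

theorem hasConicalBoundary_of_double_real {p : MvPolynomial (Fin 2) ℂ} {r₀ r₁ : ℝ}
    {κ l₀ l₁ c : ℂ} (hr : r₀ ≠ 0 ∨ r₁ ≠ 0) (hκ : κ ≠ 0)
    (hp : ∀ z : Fin 2 → ℂ, eval z p = κ * (r₀ * z 0 + r₁ * z 1) ^ 2 + l₀ * z 0 + l₁ * z 1 + c) :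
    HasConicalBoundary p := by
  have hdet : r₀ * r₀ - r₁ * (-r₁) ≠ 0 := by
    have : 0 < r₀ ^ 2 + r₁ ^ 2 := by
      rcases hr with h | h <;> positivity
    nlinarith
  have hdetC : (r₀ : ℂ) * r₀ - (-r₁) * r₁ ≠ 0 := by
    have : (r₀ : ℂ) * r₀ - (-r₁) * r₁ = ((r₀ * r₀ - r₁ * (-r₁) : ℝ) : ℂ) := by push_cast; ring
    rw [this]
    exact_mod_cast hdet
  -- The linear part is expanded along `(r₀, r₁)` and the orthogonal `(-r₁, r₀)`; `v = 0` gives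
  -- parallel lines, `v ≠ 0` a parabola.
  obtain ⟨u, v, hu, hv⟩ := exists_linear_system_solution hdetC l₀ l₁
  set a₀ : ℂ := -u / (2 * κ) with ha
  set m : ℂ := v / κ with hm
  set d : ℂ := a₀ ^ 2 - c / κ with hd
  have hp' : ∀ z : Fin 2 → ℂ, eval z p = κ * ((r₀ * z 0 + r₁ * z 1 - a₀) ^ 2 +
      m * (((-r₁ : ℝ) : ℂ) * z 0 + r₀ * z 1) - d) := by
    intro z
    rw [hp, ha, hm, hd, ha]
    push_cast
    field_simp
    linear_combination -4 * κ * z 0 * hu - 4 * κ * z 1 * hv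
  by_cases hm0 : m = 0
  · obtain ⟨e, he⟩ := IsAlgClosed.exists_pow_nat_eq d (n := 2) (by norm_num)
    obtain ⟨T, hTre, hTim, hre, him⟩ := real_form_affine_coordinates hdet a₀.im 0
    have hI : imagProjection p = T ⁻¹' {t | t.re ^ 2 = e.im ^ 2} := by
      ext y
      rw [Set.mem_preimage, Set.mem_ofPred_eq, hTre, sq_eq_sq_iff_eq_or_eq_neg]
      constructor
      · rintro ⟨z, hz0, hz⟩
        rw [hp', hm0] at hz0
        have h1 := (mul_eq_zero.1 hz0).resolve_left hκ
        have h2 : (r₀ * z 0 + r₁ * z 1 - a₀) ^ 2 = e ^ 2 := by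
          rw [he]
          linear_combination h1
        rcases sq_eq_sq_iff_eq_or_eq_neg.1 h2 with h3 | h3
        · left
          rw [← h3]
          simp [hz]
        · right
          have := congrArg Complex.im h3
          simpa [hz] using this
      · intro h
        obtain ⟨x, hx⟩ : ∃ x : ℝ, ((x : ℂ) + Complex.I * (r₀ * y 0 + r₁ * y 1 - a₀.im : ℝ)) ^ 2 =
            e ^ 2 := by
          rcases h with h | h
          · refine ⟨e.re, ?_⟩
            rw [h]
            congr 1
            apply Complex.ext <;> simp
          · refine ⟨-e.re, ?_⟩
            rw [h, ← neg_sq e]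
            congr 1
            apply Complex.ext <;> simp
        obtain ⟨z, hz, hzr, -⟩ := exists_vector_of_real_forms hdet y (x + a₀.re) 0
        refine ⟨z, ?_, hz⟩
        have h4 : ((r₀ : ℂ) * z 0 + r₁ * z 1 - a₀) =
            (x : ℂ) + Complex.I * (r₀ * y 0 + r₁ * y 1 - a₀.im : ℝ) := by
          rw [hzr]
          apply Complex.ext <;> simp
        rw [hp', hm0, h4, hx, he]
        ring
    rw [HasConicalBoundary, imagBoundary_of_eq_preimage T hI]
    exact isConicalSet_frontier_parallel_lines e.im T hre him
  · obtain ⟨T, hTre, hTim, hre, him⟩ := real_form_affine_coordinates hdet a₀.im (d / m).im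
    have hI : imagProjection p = T ⁻¹' parabolaProjection (-1 / m) := by
      ext y
      have hsq : ∀ x w : ℝ, (-1 / m * ((x : ℂ) + Complex.I * w) ^ 2).im =
          (-1 / m).im * (x ^ 2 - w ^ 2) + 2 * (-1 / m).re * x * w := by
        intro x w
        have : ((x : ℂ) + Complex.I * w) ^ 2 = ⟨x ^ 2 - w ^ 2, 2 * x * w⟩ := by
          apply Complex.ext <;> simp [sq]
          ring
        rw [this, Complex.mul_im]
        ring
      constructor
      · rintro ⟨z, hz0, hz⟩
        rw [hp'] at hz0
        have h1 := (mul_eq_zero.1 hz0).resolve_left hκ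
        refine ⟨(r₀ * z 0 + r₁ * z 1 - a₀).re, ?_⟩
        rw [hTre, hTim, ← hsq]
        have h2 : (((r₀ * z 0 + r₁ * z 1 - a₀).re : ℝ) : ℂ) +
            Complex.I * (r₀ * y 0 + r₁ * y 1 - a₀.im : ℝ) = r₀ * z 0 + r₁ * z 1 - a₀ := by
          apply Complex.ext <;> simp [hz]
        have h3 : ((-r₁ : ℝ) : ℂ) * z 0 + r₀ * z 1 - d / m =
            -1 / m * (r₀ * z 0 + r₁ * z 1 - a₀) ^ 2 := by
          field_simp
          linear_combination h1
        rw [h2, ← h3]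
        simp [hz]
      · rintro ⟨x, hx⟩
        rw [hTre, hTim, ← hsq] at hx
        set w : ℂ := -1 / m * ((x : ℂ) + Complex.I * (r₀ * y 0 + r₁ * y 1 - a₀.im : ℝ)) ^ 2 with hw
        obtain ⟨z, hz, hzr, hzs⟩ :=
          exists_vector_of_real_forms hdet y (x + a₀.re) (w.re + (d / m).re)
        refine ⟨z, ?_, hz⟩
        have h4 : (r₀ : ℂ) * z 0 + r₁ * z 1 - a₀ =
            (x : ℂ) + Complex.I * (r₀ * y 0 + r₁ * y 1 - a₀.im : ℝ) := by
          rw [hzr]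
          apply Complex.ext <;> simp
        have h5 : ((-r₁ : ℝ) : ℂ) * z 0 + r₀ * z 1 = w + d / m := by
          rw [hzs]
          apply Complex.ext
          · simp
          · simp only [Complex.add_im, Complex.ofReal_im, Complex.I_mul_im, Complex.ofReal_re]
            linarith
        rw [hp', h4, h5, hw]
        field_simp
        ring
    rw [HasConicalBoundary, imagBoundary_of_eq_preimage T hI]
    exact isConicalSet_frontier_parabolaProjection (div_ne_zero (neg_ne_zero.2 one_ne_zero) hm0)
      T hre him

theorem exists_real_multiple {α₀ α₁ : ℂ} (h0 : α₀ ≠ 0 ∨ α₁ ≠ 0)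
    (h : α₀.re * α₁.im - α₁.re * α₀.im = 0) :
    ∃ (l : ℂ) (r₀ r₁ : ℝ), l ≠ 0 ∧ α₀ = l * r₀ ∧ α₁ = l * r₁ ∧ (r₀ ≠ 0 ∨ r₁ ≠ 0) := by
  by_cases hα : α₀ = 0
  · exact ⟨α₁, 0, 1, h0.resolve_left (not_not.2 hα), by simp [hα], by simp, Or.inr one_ne_zero⟩
  · refine ⟨α₀, 1, (α₁ / α₀).re, hα, by simp, ?_, Or.inl one_ne_zero⟩
    have him : (α₁ / α₀).im = 0 := by
      rw [Complex.div_im, ← sub_div]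
      rw [div_eq_zero_iff]
      left
      linarith
    have : (((α₁ / α₀).re : ℝ) : ℂ) = α₁ / α₀ := Complex.ext rfl (by rw [him]; rfl)
    rw [this, mul_div_cancel₀ _ hα]

/-- The imaginary projection of `p` is, in suitable affine coordinates, `solvableShifts a γ`. -/
def HasShiftForm (p : MvPolynomial (Fin 2) ℂ) : Prop :=
  ∃ (T : (Fin 2 → ℝ) ≃ₜ ℂ) (a γ : ℂ), imagProjection p = T ⁻¹' solvableShifts a γ ∧
    IsPolyFun 1 (fun y => (T y).re) ∧ IsPolyFun 1 (fun y => (T y).im) ∧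
    (HasRealCoeffs p → a = 0)

/-- In the basis `α`, `ᾱ` write `β = a α + b ᾱ`; here `b ≠ 0` because the factors are not
proportional, and division by `b` gives the normal form. A real quadratic form vanishing at `(α₁,
-α₀)` also vanishes at the conjugate point, which forces `β` to be a multiple of `ᾱ`, so `a = 0`. -/
theorem hasShiftForm_of_nonreal_factor {p : MvPolynomial (Fin 2) ℂ}
    {α₀ α₁ β₀ β₁ a₀ b₀ γ : ℂ} (hα : α₀.re * α₁.im - α₁.re * α₀.im ≠ 0)
    (hαβ : α₀ * β₁ - α₁ * β₀ ≠ 0)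
    (hp : ∀ z : Fin 2 → ℂ, eval z p =
      (α₀ * z 0 + α₁ * z 1 - a₀) * (β₀ * z 0 + β₁ * z 1 - b₀) + γ)
    (hreal : HasRealCoeffs p → conj (α₀ * β₀) = α₀ * β₀ ∧
      conj (α₀ * β₁ + α₁ * β₀) = α₀ * β₁ + α₁ * β₀ ∧ conj (α₁ * β₁) = α₁ * β₁) :
    HasShiftForm p := by
  have hdet : α₀ * conj α₁ - conj α₀ * α₁ ≠ 0 := fun h => hα (by
    have := congrArg Complex.im h
    simp at this
    linarith)
  obtain ⟨a, b, h0, h1⟩ := exists_linear_system_solution hdet β₀ β₁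
  have hb : b ≠ 0 := by
    rintro rfl
    apply hαβ
    rw [← h0, ← h1]
    ring
  have hp' : ∀ z : Fin 2 → ℂ, eval z p = b * ((α₀ * z 0 + α₁ * z 1 - a₀) *
      ((a / b * α₀ + conj α₀) * z 0 + (a / b * α₁ + conj α₁) * z 1 - b₀ / b) + γ / b) := by
    intro z
    rw [hp, ← h0, ← h1]
    field_simp
  have hμ : (2 * Complex.I * conj α₀).re * (2 * Complex.I * conj α₁).im -
      (2 * Complex.I * conj α₁).re * (2 * Complex.I * conj α₀).im ≠ 0 := by
    intro h
    apply hα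
    simp at h
    linarith
  obtain ⟨T, hT, hre, him⟩ := exists_affine_homeomorph hμ (conj a₀ + a / b * a₀ - b₀ / b)
  refine ⟨T, a / b, γ / b, ?_, hre, him, fun hr => ?_⟩
  · ext y
    rw [mem_imagProjection_iff_mem_solvableShifts hα hb hp', Set.mem_preimage, hT]
  · obtain ⟨e0, e1, e2⟩ := hreal hr
    simp only [map_mul, map_add] at e0 e1 e2
    have hprod : (α₀ * conj α₁ - conj α₀ * α₁) * (β₀ * conj α₁ - β₁ * conj α₀) = 0 := by
      linear_combination -(conj α₁ ^ 2 * e0 - conj α₀ * conj α₁ * e1 + conj α₀ ^ 2 * e2)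
    have hβ := (mul_eq_zero.1 hprod).resolve_left hdet
    rw [← h0, ← h1] at hβ
    have : (α₀ * conj α₁ - conj α₀ * α₁) * a = 0 := by linear_combination hβ
    rw [(mul_eq_zero.1 this).resolve_left hdet, zero_div]

theorem hasConicalBoundary_or_hasShiftForm {p : MvPolynomial (Fin 2) ℂ} (hp : IsComplexConic p) :
    HasConicalBoundary p ∨ HasShiftForm p := by
  obtain ⟨q₀, q₁, q₂, l₀, l₁, c, heval, hq, hreal⟩ := exists_eval_eq_of_totalDegree_eq_two hp
  obtain ⟨α₀, α₁, β₀, β₁, rfl, rfl, rfl, hα0, hβ0⟩ := exists_binary_quadratic_eq_mul _ _ _ hq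
  by_cases hαβ : α₀ * β₁ - α₁ * β₀ = 0
  · left
    obtain ⟨ρ, hρ0, hρ1⟩ : ∃ ρ, β₀ = ρ * α₀ ∧ β₁ = ρ * α₁ := by
      by_cases h : α₀ = 0
      · have h1 : α₁ ≠ 0 := hα0.resolve_left (not_not.2 h)
        refine ⟨β₁ / α₁, ?_, (div_mul_cancel₀ _ h1).symm⟩
        rw [h] at hαβ ⊢
        simpa [h1] using hαβ
      · refine ⟨β₀ / α₀, (div_mul_cancel₀ _ h).symm, ?_⟩
        field_simp
        linear_combination hαβ
    have hρ : ρ ≠ 0 := by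
      rintro rfl
      simp [hρ0, hρ1] at hβ0
    by_cases hα : α₀.re * α₁.im - α₁.re * α₀.im = 0
    · obtain ⟨l, r₀, r₁, hl, rfl, rfl, hr⟩ := exists_real_multiple hα0 hα
      refine hasConicalBoundary_of_double_real (κ := ρ * l ^ 2) (l₀ := l₀) (l₁ := l₁) (c := c) hr
        (mul_ne_zero hρ (pow_ne_zero 2 hl)) fun z => ?_
      rw [heval, hρ0, hρ1]
      ring
    · refine hasConicalBoundary_of_eq_univ (imagProjection_eq_univ_of_double_nonreal
        (l₀ := l₀) (l₁ := l₁) (c := c) hα hρ fun z => ?_)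
      rw [heval, hρ0, hρ1]
      ring
  · have hdet : α₀ * β₁ - β₀ * α₁ ≠ 0 := by rwa [mul_comm β₀]
    -- Independent factors allow a translation that absorbs all linear terms.
    obtain ⟨b₀, a₀, h0, h1⟩ : ∃ b₀ a₀, α₀ * b₀ + β₀ * a₀ = -l₀ ∧ α₁ * b₀ + β₁ * a₀ = -l₁ :=
      exists_linear_system_solution hdet _ _
    have heval' : ∀ z : Fin 2 → ℂ, eval z p =
        (α₀ * z 0 + α₁ * z 1 - a₀) * (β₀ * z 0 + β₁ * z 1 - b₀) + (c - a₀ * b₀) := by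
      intro z
      rw [heval]
      linear_combination z 0 * h0 + z 1 * h1
    by_cases hα : α₀.re * α₁.im - α₁.re * α₀.im = 0
    · by_cases hβ : β₀.re * β₁.im - β₁.re * β₀.im = 0
      · left
        obtain ⟨l, r₀, r₁, hl, rfl, rfl, -⟩ := exists_real_multiple hα0 hα
        obtain ⟨m, s₀, s₁, hm, rfl, rfl, -⟩ := exists_real_multiple hβ0 hβ
        refine hasConicalBoundary_of_hyperbola (r₀ := r₀) (r₁ := r₁) (s₀ := s₀) (s₁ := s₁)
          (κ := l * m) (a₀ := a₀ / l) (b₀ := b₀ / m) (δ := -(c - a₀ * b₀) / (l * m)) ?_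
          (mul_ne_zero hl hm) fun z => ?_
        · intro h
          apply hαβ
          have : (r₀ : ℂ) * s₁ - r₁ * s₀ = 0 := by exact_mod_cast h
          linear_combination l * m * this
        · rw [heval']
          field_simp
          ring
      · right
        refine hasShiftForm_of_nonreal_factor (β₀ := α₀) (β₁ := α₁) (a₀ := b₀) (b₀ := a₀) (γ := c - a₀ * b₀) hβ
          (fun h => hαβ (by linear_combination -h)) (fun z => ?_) fun hr => ?_
        · rw [heval']
          ring
        · obtain ⟨e0, e1, e2⟩ := hreal hr
          refine ⟨by rwa [mul_comm], ?_, by rwa [mul_comm]⟩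
          rw [show β₀ * α₁ + β₁ * α₀ = α₀ * β₁ + α₁ * β₀ by ring]
          exact e1
    · exact Or.inr (hasShiftForm_of_nonreal_factor hα hαβ heval' hreal)

/-! ### Degree bounds and boundedness of the complement -/

/-- `f` has real and imaginary parts given by polynomials of degree at most `d`. -/
def IsComplexPolyFun (d : ℕ) (f : (Fin 2 → ℝ) → ℂ) : Prop :=
  IsPolyFun d (fun y => (f y).re) ∧ IsPolyFun d (fun y => (f y).im)

namespace IsComplexPolyFun

variable {d e : ℕ} {f g : (Fin 2 → ℝ) → ℂ}

theorem const (c : ℂ) : IsComplexPolyFun d fun _ => c :=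
  ⟨.const _, .const _⟩

theorem add (hf : IsComplexPolyFun d f) (hg : IsComplexPolyFun d g) :
    IsComplexPolyFun d fun y => f y + g y :=
  ⟨hf.1.add hg.1, hf.2.add hg.2⟩

theorem sub (hf : IsComplexPolyFun d f) (hg : IsComplexPolyFun d g) :
    IsComplexPolyFun d fun y => f y - g y :=
  ⟨hf.1.sub hg.1, hf.2.sub hg.2⟩

theorem mul (hf : IsComplexPolyFun d f) (hg : IsComplexPolyFun e g) :
    IsComplexPolyFun (d + e) fun y => f y * g y := by
  refine ⟨?_, ?_⟩
  · simp only [Complex.mul_re]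
    exact (hf.1.mul hg.1).sub (hf.2.mul hg.2)
  · simp only [Complex.mul_im]
    exact (hf.1.mul hg.2).add (hf.2.mul hg.1)

theorem const_mul (c : ℂ) (hf : IsComplexPolyFun d f) : IsComplexPolyFun d fun y => c * f y := by
  simpa using (const (d := 0) c).mul hf

theorem complexConj (hf : IsComplexPolyFun d f) : IsComplexPolyFun d fun y => conj (f y) := by
  refine ⟨hf.1, ?_⟩
  simpa using hf.2.const_mul (-1)

theorem normSq (hf : IsComplexPolyFun d f) :
    IsPolyFun (d + d) fun y => Complex.normSq (f y) := by
  simp only [Complex.normSq_apply]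
  exact (hf.1.mul hf.1).add (hf.2.mul hf.2)

end IsComplexPolyFun

theorem isPolyFun_shiftDiscriminant (a γ : ℂ) {τ : (Fin 2 → ℝ) → ℂ} (hτ : IsComplexPolyFun 1 τ) :
    IsPolyFun 8 fun y => shiftDiscriminant a γ (τ y) := by
  have hc : IsComplexPolyFun 2 fun y => cubicCoeff a γ (τ y) := by
    simp only [cubicCoeff, sq]
    exact (((hτ.mul hτ.complexConj).sub ((hτ.mul hτ).const_mul _)).add (.const _)).sub (.const _)
  have h3 : IsComplexPolyFun 6 fun y => γ * conj (cubicCoeff a γ (τ y)) ^ 3 := by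
    have : (fun y => γ * conj (cubicCoeff a γ (τ y)) ^ 3) = fun y => γ *
        (conj (cubicCoeff a γ (τ y)) * conj (cubicCoeff a γ (τ y)) *
          conj (cubicCoeff a γ (τ y))) := by
      funext y
      ring
    rw [this]
    exact ((hc.complexConj.mul hc.complexConj).mul hc.complexConj).const_mul γ
  unfold shiftDiscriminant
  exact (((hc.normSq.pow 2).add ((h3.1.const_mul 8).mono (by norm_num))).add
    ((hc.normSq.const_mul _).mono (by norm_num))).sub (.const _)

theorem HasConicalBoundary.of_preimage {p : MvPolynomial (Fin 2) ℂ} {S : Set ℂ}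
    (T : (Fin 2 → ℝ) ≃ₜ ℂ) (hI : imagProjection p = T ⁻¹' S)
    (hre : IsPolyFun 1 (fun y => (T y).re)) (him : IsPolyFun 1 (fun y => (T y).im))
    (hS : IsConicalSet (frontier S)) : HasConicalBoundary p := by
  rw [HasConicalBoundary, imagBoundary_of_eq_preimage T hI]
  exact hS T hre him

theorem isConicalSet_frontier_solvableShifts_zero (γ : ℂ) :
    IsConicalSet (frontier (solvableShifts 0 γ)) := by
  by_cases hγ : γ = 0
  · rw [hγ, solvableShifts_zero, frontier_univ]
    exact isConicalSet_empty
  set R := 2 * γ.re + 2 * ‖γ‖ with hR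
  have hset : solvableShifts 0 γ = {τ | R ≤ ‖τ‖ ^ 2} :=
    Set.ext fun τ => mem_solvableShifts_coeff_zero_iff hγ
  rcases le_or_gt R 0 with h | h
  · have : solvableShifts 0 γ = Set.univ := by
      rw [hset]
      exact Set.eq_univ_of_forall fun τ => h.trans (sq_nonneg _)
    rw [this, frontier_univ]
    exact isConicalSet_empty
  · have hball : solvableShifts 0 γ = (Metric.ball (0 : ℂ) (Real.sqrt R))ᶜ := by
      rw [hset]
      ext τ
      rw [Set.mem_compl_iff, mem_ball_zero_iff, not_lt, Real.sqrt_le_left (norm_nonneg _)]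
      rfl
    have hfront : frontier (solvableShifts 0 γ) = {τ | ‖τ‖ ^ 2 = R} := by
      rw [hball, frontier_compl, frontier_ball _ (Real.sqrt_pos.2 h).ne']
      ext τ
      rw [mem_sphere_zero_iff_norm, eq_comm, Real.sqrt_eq_iff_mul_self_eq h.le (norm_nonneg _),
        Set.mem_ofPred_eq, sq, eq_comm]
    rw [hfront]
    exact isConicalSet_circle R

theorem HasShiftForm.liesOnCurve {p : MvPolynomial (Fin 2) ℂ} (h : HasShiftForm p) :
    LiesOnCurve (imagBoundary p) 8 := by
  obtain ⟨T, a, γ, hI, hre, him, -⟩ := h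
  rw [imagBoundary_of_eq_preimage T hI]
  by_cases hγ : γ = 0
  · rw [hγ, solvableShifts_zero, frontier_univ, Set.preimage_empty]
    exact liesOnCurve_empty 8
  by_cases ha : ‖a‖ = 1
  · obtain ⟨s, hs, hmem⟩ := exists_im_ne_zero_imp_mem_solvableShifts γ ha
    have hsT : IsComplexPolyFun 1 fun y => T y * s := by
      simpa only [mul_comm] using IsComplexPolyFun.const_mul s ⟨hre, him⟩
    refine (hsT.2.liesOnCurve (y₀ := T.symm (Complex.I / s)) ?_ fun y hy => ?_).mono
      subset_rfl (by norm_num)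
    · change (T (T.symm (Complex.I / s)) * s).im ≠ 0
      rw [T.apply_symm_apply, div_mul_cancel₀ _ hs]
      simp
    · by_contra hne
      refine (hy : T y ∈ frontier _).2 ?_
      exact interior_maximal (fun τ hτ => hmem τ hτ)
        (isOpen_ne_fun (f := fun τ : ℂ => (τ * s).im) (by fun_prop) continuous_const) hne
  · obtain ⟨τ, hτ⟩ := exists_shiftDiscriminant_ne_zero γ ha
    refine (isPolyFun_shiftDiscriminant a γ ⟨hre, him⟩).liesOnCurve (y₀ := T.symm τ) ?_ fun y hy => ?_
    · rwa [T.apply_symm_apply]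
    · exact shiftDiscriminant_eq_zero_of_mem_frontier ha hγ hy

theorem HasShiftForm.isBounded_compl {p : MvPolynomial (Fin 2) ℂ} (h : HasShiftForm p) :
    Bornology.IsBounded (imagProjection p)ᶜ := by
  obtain ⟨T, a, γ, hI, -, -, -⟩ := h
  have hsub : (imagProjection p)ᶜ ⊆
      T.symm '' Metric.closedBall (0 : ℂ) (‖γ‖ + 2 * ‖a‖ + 3) := by
    intro y hy
    refine ⟨T y, ?_, T.symm_apply_apply y⟩
    rw [mem_closedBall_zero_iff]
    by_contra hlt
    apply hy
    rw [hI]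
    exact mem_solvableShifts_of_large_norm (not_le.1 hlt).le
  exact ((isCompact_closedBall (0 : ℂ) _).image T.symm.continuous).isBounded.subset hsub

/-- Every component of a bounded complement is bounded, so there can be none. -/
theorem imagProjection_eq_univ_of_isBounded_compl {n : ℕ} {p : MvPolynomial (Fin n) ℂ}
    (hb : Bornology.IsBounded (imagProjection p)ᶜ) (h : NoBoundedComplementComponent p) :
    imagProjection p = Set.univ :=
  Set.eq_univ_of_forall fun y => by
    by_contra hy
    exact h y hy (hb.subset (connectedComponentIn_subset _ _))

theorem HasConicalBoundary.isAlgebraicSet_and_componentsHaveDegreeAtMost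
    {p : MvPolynomial (Fin 2) ℂ} (h : HasConicalBoundary p) :
    IsAlgebraicSet (imagBoundary p) ∧ ComponentsHaveDegreeAtMost (imagBoundary p) 2 :=
  ⟨h.1, h.2.componentsHaveDegreeAtMost one_le_two⟩

theorem IsComplexConic.liesOnCurve_imagBoundary {p : MvPolynomial (Fin 2) ℂ}
    (hp : IsComplexConic p) : LiesOnCurve (imagBoundary p) 8 := by
  rcases hasConicalBoundary_or_hasShiftForm hp with h | h
  · exact h.2.mono subset_rfl (by norm_num)
  · exact h.liesOnCurve

theorem IsComplexConic.hasConicalBoundary_of_noBoundedComplementComponent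
    {p : MvPolynomial (Fin 2) ℂ} (hp : IsComplexConic p) (hb : NoBoundedComplementComponent p) :
    HasConicalBoundary p := by
  rcases hasConicalBoundary_or_hasShiftForm hp with h | h
  · exact h
  · exact hasConicalBoundary_of_eq_univ
      (imagProjection_eq_univ_of_isBounded_compl h.isBounded_compl hb)

theorem IsComplexConic.hasConicalBoundary_of_hasRealCoeffs {p : MvPolynomial (Fin 2) ℂ}
    (hp : IsComplexConic p) (hr : HasRealCoeffs p) : HasConicalBoundary p := by
  rcases hasConicalBoundary_or_hasShiftForm hp with h | ⟨T, a, γ, hI, hre, him, ha⟩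
  · exact h
  · rw [ha hr] at hI
    exact .of_preimage T hI hre him (isConicalSet_frontier_solvableShifts_zero γ)

/-! ### A conic whose boundary is a line segment -/

/-- The conic `i z₁² + z₁ z₂ + i`. -/
noncomputable def slitConic : MvPolynomial (Fin 2) ℂ :=
  C Complex.I * X 0 ^ 2 + X 0 * X 1 + C Complex.I

theorem finSuccEquiv_C_one (c : ℂ) :
    MvPolynomial.finSuccEquiv ℂ 1 (C c) = Polynomial.C (C c) := by
  simp [MvPolynomial.finSuccEquiv_apply]

theorem finSuccEquiv_X_one_one : MvPolynomial.finSuccEquiv ℂ 1 (X 1) = Polynomial.C (X 0) :=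
  MvPolynomial.finSuccEquiv_X_succ (j := 0)

theorem isComplexConic_of_natDegree {p : MvPolynomial (Fin 2) ℂ} (hle : p.totalDegree ≤ 2)
    (h : (MvPolynomial.finSuccEquiv ℂ 1 p).natDegree = 2) : IsComplexConic p :=
  le_antisymm hle ((h.symm.trans (natDegree_finSuccEquiv p)).le.trans
    (degreeOf_le_totalDegree p 0))

theorem isComplexConic_slitConic : IsComplexConic slitConic := by
  apply isComplexConic_of_natDegree
  · refine (totalDegree_add _ _).trans (max_le ((totalDegree_add _ _).trans (max_le ?_ ?_)) ?_)
    · exact (totalDegree_mul _ _).trans (by simp [totalDegree_X_pow])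
    · exact (totalDegree_mul _ _).trans (by simp [totalDegree_X])
    · simp
  · simp only [slitConic, map_add, map_mul, map_pow, finSuccEquiv_C_one, finSuccEquiv_X_one_one,
      MvPolynomial.finSuccEquiv_X_zero]
    have hI : (C Complex.I : MvPolynomial (Fin 1) ℂ) ≠ 0 := by
      rw [Ne, C_eq_zero]
      exact Complex.I_ne_zero
    compute_degree!

theorem eval_slitConic (z : Fin 2 → ℂ) :
    eval z slitConic = Complex.I * z 0 ^ 2 + z 0 * z 1 + Complex.I := by
  simp [slitConic]

/-- For `w = z₁ ≠ 0` the conic gives `z₂ = -i (w + 1/w)`, so `Im z₂ = -Re (w + 1/w)`. -/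
theorem mem_imagProjection_slitConic_of_eq {y : Fin 2 → ℝ} {x : ℝ} (h0 : x ^ 2 + y 0 ^ 2 ≠ 0)
    (hx : x + x / (x ^ 2 + y 0 ^ 2) = -y 1) : y ∈ imagProjection slitConic := by
  set w : ℂ := ⟨x, y 0⟩ with hw
  have hn : Complex.normSq w = x ^ 2 + y 0 ^ 2 := by rw [Complex.normSq_apply]; ring
  have hw0 : w ≠ 0 := by
    rw [← Complex.normSq_pos, hn]
    positivity
  refine ⟨![w, -Complex.I * (w + w⁻¹)], ?_, fun j => ?_⟩
  · rw [eval_slitConic]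
    simp only [Matrix.cons_val_zero, Matrix.cons_val_one]
    field_simp
    ring
  · fin_cases j
    · rfl
    · change (-Complex.I * (w + w⁻¹)).im = y 1
      have : (w + w⁻¹).re = -y 1 := by
        rw [← hx, Complex.add_re, Complex.inv_re, hn]
      simp only [neg_mul, Complex.neg_im, Complex.I_mul_im, this, neg_neg]

theorem mem_imagProjection_slitConic_of_ne_zero {y : Fin 2 → ℝ} (hy : y 0 ≠ 0) :
    y ∈ imagProjection slitConic := by
  have hpos : ∀ x : ℝ, 0 < x ^ 2 + y 0 ^ 2 := fun x => by positivity
  let g : ℝ → ℝ := fun x => x + x / (x ^ 2 + y 0 ^ 2)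
  have hg : Continuous g :=
    continuous_id.add (continuous_id.div (by fun_prop) fun x => (hpos x).ne')
  obtain ⟨x, hx⟩ := mem_range_of_exists_le_of_exists_ge (c := -y 1) hg
    ⟨-|y 1|, by
      have : -|y 1| / ((-|y 1|) ^ 2 + y 0 ^ 2) ≤ 0 :=
        div_nonpos_of_nonpos_of_nonneg (neg_nonpos.2 (abs_nonneg _)) (hpos _).le
      simp only [g]
      linarith [le_abs_self (y 1)]⟩
    ⟨|y 1|, by
      have : 0 ≤ |y 1| / (|y 1| ^ 2 + y 0 ^ 2) := div_nonneg (abs_nonneg _) (hpos _).le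
      simp only [g]
      linarith [neg_abs_le (y 1)]⟩
  exact mem_imagProjection_slitConic_of_eq (hpos x).ne' hx

theorem mem_imagProjection_slitConic_of_two_le {y : Fin 2 → ℝ} (hy : 2 ≤ y 1) :
    y ∈ imagProjection slitConic := by
  by_cases h0 : y 0 = 0
  · have hD : 0 ≤ y 1 ^ 2 - 4 := by nlinarith
    have hs := Real.sq_sqrt hD
    obtain ⟨x, hq⟩ : ∃ x : ℝ, x ^ 2 + y 1 * x + 1 = 0 :=
      ⟨(-y 1 - Real.sqrt (y 1 ^ 2 - 4)) / 2, by linear_combination hs / 4⟩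
    have hx0 : x ≠ 0 := by
      intro h
      rw [h] at hq
      norm_num at hq
    refine mem_imagProjection_slitConic_of_eq (x := x) (by rw [h0]; simpa using hx0) ?_
    rw [h0]
    field_simp
    linear_combination x * hq
  · exact mem_imagProjection_slitConic_of_ne_zero h0

/-- For real `z₁ = x` the imaginary part of the equation is `x² + y₁ x + 1 = 0`, whose discriminant
is negative. -/
theorem notMem_imagProjection_slitConic {y : Fin 2 → ℝ} (h0 : y 0 = 0) (h1 : y 1 ^ 2 < 4) :
    y ∉ imagProjection slitConic := by
  rintro ⟨z, hz0, hz⟩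
  rw [eval_slitConic] at hz0
  have him := congrArg Complex.im hz0
  have e0 := hz 0
  rw [h0] at e0
  simp [sq, e0, hz 1] at him
  nlinarith [sq_nonneg ((z 0).re + y 1 / 2)]

theorem not_isAlgebraicSet_imagBoundary_slitConic :
    ¬ IsAlgebraicSet (imagBoundary slitConic) := by
  rintro ⟨J, hJ⟩
  have hout : (![0, 3] : Fin 2 → ℝ) ∉ imagBoundary slitConic := by
    rw [imagBoundary_eq_frontier]
    intro h
    refine h.2 (interior_maximal (t := {y : Fin 2 → ℝ | 2 < y 1})
      (fun y hy => mem_imagProjection_slitConic_of_two_le (le_of_lt hy))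
      (isOpen_lt continuous_const (continuous_apply 1)) ?_)
    change (2 : ℝ) < 3
    norm_num
  have hin : ∀ s : ℝ, s ^ 2 < 4 → (![0, s] : Fin 2 → ℝ) ∈ imagBoundary slitConic := by
    intro s hs
    refine ⟨?_, subset_closure (notMem_imagProjection_slitConic rfl hs)⟩
    have hc : Continuous fun ε : ℝ => (![ε, s] : Fin 2 → ℝ) := by
      refine continuous_pi fun i => ?_
      fin_cases i
      · exact continuous_id
      · exact continuous_const
    refine mem_closure_of_tendsto (b := 𝓝[≠] (0 : ℝ))
      ((hc.tendsto 0).mono_left nhdsWithin_le_nhds) ?_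
    filter_upwards [self_mem_nhdsWithin] with ε hε
    exact mem_imagProjection_slitConic_of_ne_zero hε
  rw [hJ, mem_zeroLocus_iff] at hout
  push Not at hout
  obtain ⟨f, hfJ, hf⟩ := hout
  -- The restriction of `f` to the line through the segment has infinitely many roots, so it also
  -- vanishes at the excluded point `(0, 3)`.
  let q : Polynomial ℝ := aeval ![0, Polynomial.X] f
  have hq : ∀ s : ℝ, Polynomial.eval s q = aeval (![0, s] : Fin 2 → ℝ) f := by
    intro s
    have : (Polynomial.aeval s).comp (aeval (![0, Polynomial.X] : Fin 2 → Polynomial ℝ)) =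
        (aeval (![0, s] : Fin 2 → ℝ) : MvPolynomial (Fin 2) ℝ →ₐ[ℝ] ℝ) := by
      apply algHom_ext
      intro i
      fin_cases i <;> simp
    have := DFunLike.congr_fun this f
    simpa [q] using this
  have hq0 : q = 0 := by
    refine Polynomial.eq_zero_of_infinite_isRoot q
      ((Set.Ioo_infinite (show (0 : ℝ) < 1 by norm_num)).mono fun s hs => ?_)
    have hmem := hin s (by nlinarith [hs.1, hs.2])
    rw [hJ] at hmem
    exact (hq s).trans (hmem f hfJ)
  apply hf
  rw [← hq, hq0, Polynomial.eval_zero]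

/-! ### The conic with a boundary of degree eight -/

theorem isComplexConic_exampleConic : IsComplexConic exampleConic := by
  apply isComplexConic_of_natDegree
  · refine (totalDegree_add _ _).trans (max_le ((totalDegree_add _ _).trans (max_le ?_ ?_)) ?_)
    · simp [totalDegree_X_pow]
    · exact (totalDegree_mul _ _).trans (by simp [totalDegree_X_pow])
    · simp [totalDegree_X]
  · simp only [exampleConic, map_add, map_mul, map_pow, finSuccEquiv_C_one, finSuccEquiv_X_one_one,
      MvPolynomial.finSuccEquiv_X_zero]
    rw [← Polynomial.C_pow, ← Polynomial.C_mul]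
    compute_degree!

theorem eval_exampleConic (z : Fin 2 → ℂ) :
    eval z exampleConic = z 0 ^ 2 + Complex.I * z 1 ^ 2 + z 1 := by
  simp [exampleConic]

theorem eval_exampleOctic_eq_zero_of_mem_imagBoundary {y : Fin 2 → ℝ}
    (hy : y ∈ imagBoundary exampleConic) : eval y (exampleOctic ℝ) = 0 := by
  obtain ⟨r, hr⟩ : ∃ r : ℝ, r ^ 2 = 1 / 2 := ⟨Real.sqrt (1 / 2), Real.sq_sqrt (by norm_num)⟩
  have hr0 : r ≠ 0 := by
    rintro rfl
    norm_num at hr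
  have hrC : (r : ℂ) ^ 2 = 1 / 2 := by
    rw [← Complex.ofReal_pow, hr]
    norm_num
  have hI2 := Complex.I_sq
  -- With `e² = -i` the quadratic part is `(z₁ + e z₂)(z₁ - e z₂)`; then `a` and `1 + i` come from
  -- writing the second factor through the first and its conjugate.
  set e : ℂ := r * (1 - Complex.I) with he
  have hee : e ^ 2 = -Complex.I := by
    rw [he]
    linear_combination (1 - Complex.I) ^ 2 * hrC + hI2 / 2
  have hce : conj e = Complex.I * e := by
    rw [he]
    simp only [map_mul, map_sub, map_one, Complex.conj_ofReal, Complex.conj_I]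
    linear_combination (r : ℂ) * hI2
  have hdet : (1 : ℂ).re * e.im - e.re * (1 : ℂ).im ≠ 0 := by simpa [he] using hr0
  set a : ℂ := -(1 + Complex.I) / 2 with ha
  set γ : ℂ := (1 + Complex.I) / 8 with hγ
  have hk : (1 + Complex.I : ℂ) ≠ 0 := fun h => by simpa using congrArg Complex.re h
  have hp : ∀ z : Fin 2 → ℂ, eval z exampleConic = (1 + Complex.I) *
      ((1 * z 0 + e * z 1 - e * Complex.I / 2) * ((a * 1 + conj 1) * z 0 +
        (a * e + conj e) * z 1 - -(e * Complex.I * (1 - Complex.I) / 4)) + γ) := by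
    intro z
    rw [eval_exampleConic, hce, map_one, ha, hγ]
    clear_value e
    grind
  have hμ : (2 * Complex.I * conj (1 : ℂ)).re * (2 * Complex.I * conj e).im -
      (2 * Complex.I * conj e).re * (2 * Complex.I * conj (1 : ℂ)).im ≠ 0 := by
    simpa [he] using hr0
  obtain ⟨T, hT, -, -⟩ := exists_affine_homeomorph hμ
    (conj (e * Complex.I / 2) + a * (e * Complex.I / 2) -
      -(e * Complex.I * (1 - Complex.I) / 4))
  have hI : imagProjection exampleConic = T ⁻¹' solvableShifts a γ := by
    ext y
    rw [mem_imagProjection_iff_mem_solvableShifts hdet hk hp, Set.mem_preimage, hT]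
  rw [imagBoundary_of_eq_preimage T hI] at hy
  have han : ‖a‖ ≠ 1 := by
    intro h
    have h2 : Complex.normSq a = 1 := by rw [Complex.normSq_eq_norm_sq, h, one_pow]
    rw [ha, Complex.normSq_apply] at h2
    norm_num at h2
  have hγ0 : γ ≠ 0 := div_ne_zero hk (by norm_num)
  have hdisc := shiftDiscriminant_eq_zero_of_mem_frontier han hγ0 hy
  have hTy : T y = 2 * Complex.I * y 0 - 2 * e * (y 1 - 1 / 2) := by
    rw [hT, ha]
    simp only [map_one, map_mul, map_div₀, hce, Complex.conj_I, map_ofNat]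
    clear_value e
    grind
  have hcTy : conj (T y) = -2 * Complex.I * y 0 - 2 * (Complex.I * e) * (y 1 - 1 / 2) := by
    rw [hTy]
    simp only [map_sub, map_mul, map_div₀, hce, Complex.conj_I, map_ofNat, Complex.conj_ofReal,
      map_one]
    ring
  have hcoeff : cubicCoeff a γ (T y) =
      ⟨2 * y 0 ^ 2 + 2 * (y 1 - 1 / 2) ^ 2 - 1 / 8, 2 * y 0 ^ 2 - 2 * (y 1 - 1 / 2) ^ 2 + 1 / 8⟩ := by
    have hmk : (⟨2 * y 0 ^ 2 + 2 * (y 1 - 1 / 2) ^ 2 - 1 / 8,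
        2 * y 0 ^ 2 - 2 * (y 1 - 1 / 2) ^ 2 + 1 / 8⟩ : ℂ) =
        2 * (1 + Complex.I) * y 0 ^ 2 + 2 * (1 - Complex.I) * ((y 1 : ℂ) - 1 / 2) ^ 2 -
          (1 - Complex.I) / 8 := by
      rw [Complex.mk_eq_add_mul_I]
      push_cast
      ring
    rw [hmk, cubicCoeff, hcTy, hTy, ha, hγ]
    simp only [map_div₀, map_neg, map_add, map_one, Complex.conj_I, map_ofNat]
    clear_value e
    grind
  have hfinal : shiftDiscriminant a γ (T y) = 64 * eval y (exampleOctic ℝ) := by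
    rw [shiftDiscriminant, hcoeff, hγ]
    have hoct : eval y (exampleOctic ℝ) = y 0 ^ 8 + (2 * (y 1 - 1 / 2) ^ 4 +
        5 / 4 * (y 1 - 1 / 2) ^ 2 - 1 / 64) * y 0 ^ 4 +
        (y 1 - 1 / 2) ^ 2 * ((y 1 - 1 / 2) ^ 2 - 1 / 4) ^ 3 := by
      simp [exampleOctic]
    rw [hoct]
    simp [pow_succ, Complex.normSq_apply]
    ring
  rw [hfinal] at hdisc
  linarith

/-- For each `t` in `(0, 1/4)` the line `y₀ = t` meets both the projection and its complement, so by
connectedness it carries a boundary point. -/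
theorem infinite_imagBoundary_exampleConic : (imagBoundary exampleConic).Infinite := by
  refine Set.Infinite.of_image (fun y => y 0)
    ((Set.Ioo_infinite (show (0 : ℝ) < 1 / 4 by norm_num)).mono fun t ht => ?_)
  let c : ℝ → Fin 2 → ℝ := fun s => ![t, s]
  have hc : Continuous c := by
    refine continuous_pi fun i => ?_
    fin_cases i
    · exact continuous_const
    · exact continuous_id
  -- At `Im z₂ = 1/2` the real part reduces to `(Re z₁)² = t²`, and for small `t` the imaginary part
  -- is then positive.
  have hout : (1 / 2 : ℝ) ∉ c ⁻¹' imagProjection exampleConic := by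
    rintro ⟨z, hz0, hz⟩
    rw [eval_exampleConic] at hz0
    have e0 : (z 0).im = t := hz 0
    have e1 : (z 1).im = 1 / 2 := hz 1
    have hre := congrArg Complex.re hz0
    have him := congrArg Complex.im hz0
    simp [sq, e0, e1] at hre him
    have h1 : ((z 0).re - t) * ((z 0).re + t) = 0 := by linarith
    have h2 : t ^ 2 < 1 / 16 := by nlinarith [ht.1, ht.2]
    nlinarith [sq_nonneg ((z 0).re + t), sq_nonneg ((z 1).re)]
  have hin : ∃ s, s ∈ c ⁻¹' imagProjection exampleConic := by
    set D : ℝ := 1 / 16 + t ^ 4 with hD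
    have hD0 : 0 ≤ D := by positivity
    have hs := Real.sq_sqrt hD0
    -- For `z₁ = it` and `z₂ = X + i(v + 1/2)` the equation gives `X = -t²/(2v)` and `u² - u/4 -
    -- t⁴/4 = 0` with `u = v²`; this is the positive root.
    set u : ℝ := (1 / 4 + Real.sqrt D) / 2 with hu
    have hu0 : 0 < u := by positivity
    have huq : u ^ 2 - u / 4 - t ^ 4 / 4 = 0 := by
      rw [hu]
      linear_combination hs / 4 + hD / 4
    have hv := Real.sq_sqrt hu0.le
    set v := Real.sqrt u
    have hv0 : v ≠ 0 := by
      intro h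
      rw [h] at hv
      norm_num at hv
      exact hu0.ne hv
    refine ⟨v + 1 / 2, ![⟨0, t⟩, ⟨-t ^ 2 / (2 * v), v + 1 / 2⟩], ?_, fun j => ?_⟩
    · rw [eval_exampleConic]
      apply Complex.ext
      · simp [sq]
        field_simp
        ring
      · simp [sq]
        field_simp
        rw [← hv] at huq
        linear_combination (-4 : ℝ) * huq
    · fin_cases j <;> rfl
  have hne : (frontier (c ⁻¹' imagProjection exampleConic)).Nonempty :=
    nonempty_frontier_iff.2 ⟨hin, fun h => hout (h ▸ Set.mem_univ _)⟩
  obtain ⟨s, hs⟩ := hne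
  refine ⟨c s, ?_, rfl⟩
  rw [imagBoundary_eq_frontier]
  exact hc.frontier_preimage_subset _ hs

theorem corollary5p4 :
    -- the boundary need not be algebraic
    (∃ p : MvPolynomial (Fin 2) ℂ, IsComplexConic p ∧ ¬ IsAlgebraicSet (imagBoundary p)) ∧
    -- the degree bound 8
    (∀ p : MvPolynomial (Fin 2) ℂ, IsComplexConic p →
      zariskiClosure (imagBoundary p) ≠ Set.univ ∧
      ComponentsHaveDegreeAtMost (imagBoundary p) 8) ∧
    -- the bound is attained
    (IsComplexConic exampleConic ∧
      IsIrreducibleAlgebraicSet (zariskiClosure (imagBoundary exampleConic)) ∧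
      HasDegree (zariskiClosure (imagBoundary exampleConic)) 8 ∧
      ∃ F : MvPolynomial (Fin 2) ℝ, F.totalDegree = 8 ∧
        Irreducible (MvPolynomial.map (algebraMap ℝ ℂ) F) ∧
        MvPolynomial.vanishingIdeal ℝ (imagBoundary exampleConic) = Ideal.span {F}) ∧
    -- no bounded components in the complement
    (∀ p : MvPolynomial (Fin 2) ℂ, IsComplexConic p → NoBoundedComplementComponent p →
      IsAlgebraicSet (imagBoundary p) ∧ ComponentsHaveDegreeAtMost (imagBoundary p) 2) ∧
    -- real coefficients
    (∀ p : MvPolynomial (Fin 2) ℂ, IsComplexConic p → HasRealCoeffs p →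
      IsAlgebraicSet (imagBoundary p) ∧ ComponentsHaveDegreeAtMost (imagBoundary p) 2) := by
  have hirrC : Irreducible (MvPolynomial.map (algebraMap ℝ ℂ) (exampleOctic ℝ)) := by
    rw [map_exampleOctic]
    exact irreducible_exampleOctic
  have hirr : Irreducible (exampleOctic ℝ) := by
    -- Base change reflects units, so irreducibility over `ℂ` descends to `ℝ`.
    have : IsLocalHom (MvPolynomial.map (σ := Fin 2) (algebraMap ℝ ℂ)) :=
      ⟨fun P hP => by simpa [MvPolynomial.isUnit_iff, coeff_map] using hP⟩
    exact hirrC.of_map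
  have hideal : MvPolynomial.vanishingIdeal ℝ (imagBoundary exampleConic) =
      Ideal.span {exampleOctic ℝ} :=
    vanishingIdeal_eq_span_of_infinite hirr infinite_imagBoundary_exampleConic
      fun _ hy => eval_exampleOctic_eq_zero_of_mem_imagBoundary hy
  refine ⟨⟨slitConic, isComplexConic_slitConic, not_isAlgebraicSet_imagBoundary_slitConic⟩,
    fun p hp => ⟨hp.liesOnCurve_imagBoundary.zariskiClosure_ne_univ,
      hp.liesOnCurve_imagBoundary.componentsHaveDegreeAtMost (by norm_num)⟩,
    ⟨isComplexConic_exampleConic, ?_, ?_, exampleOctic ℝ, totalDegree_exampleOctic, hirrC, hideal⟩,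
    fun p hp hb => (hp.hasConicalBoundary_of_noBoundedComplementComponent
      hb).isAlgebraicSet_and_componentsHaveDegreeAtMost,
    fun p hp hr => (hp.hasConicalBoundary_of_hasRealCoeffs
      hr).isAlgebraicSet_and_componentsHaveDegreeAtMost⟩
  · apply isIrreducibleAlgebraicSet_zariskiClosure
    rw [hideal, Ideal.span_singleton_prime hirr.ne_zero]
    exact hirr.prime
  · exact Or.inr ⟨exampleOctic ℝ, hirr, by rw [vanishingIdeal_zariskiClosure, hideal],
      totalDegree_exampleOctic.symm⟩
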